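/- Convention: $[g,h]=g^{-1}h^{-1}gh$. For $p\ge 3$ let $\Lambda_p\cong\mathbf Z^{p-1}\rtimes\mathbf Z$ be the group generated by $x_1,\dots,x_p$ subject to $[x_1,x_i]=x_{i+1}$ for $2\le i\le p-1$, $[x_i,x_j]=1$ for $2\le i,j\le p$, and $[x_1,x_p]=1$; its centre is generated by $x_p$. Let $\Gamma_{4,3}$ be the central product of $\Lambda_4$ and $\Lambda_3$, that is, the quotient of $\Lambda_4\times\Lambda_3$ by the central subgroup generated by $(z,z'^{-1})$, where $z$ and $z'$ are the last generators of $\Lambda_4$ and $\Lambda_3$. For a finite presentation $\langle S\mid R\rangle$ of a group, let $F_S$ be the free group on $S$ with word length $\ell$. A filling of area $k$ and diameter at most $d$ of a null-homotopic word $w\in F_S$ is an expression $w=\prod_{i=1}^k u_i^{-1}r_iu_i$ in $F_S$ with $u_i\in F_S$, $r_i\in R^{\pm1}$ and $\ell(u_i)\le d$ for all $i$. The area of $w$ is the least area of a filling of $w$, and the Dehn function $\delta(n)$ is the supremum of the areas of the null-homotopic words of length at most $n$. For functions on $\mathbf Z_{\ge 0}$, write $f\preccurlyeq g$ if there is $A\ge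 0$ with $f(n)\le A\,g(An+A)+A$ for all $n$, and $f\asymp g$ if $f\preccurlyeq g\preccurlyeq f$. **Theorem 5.6.** The group $\Gamma_{4,3}$ is finitely presented and admits $(n^3,n)$ as a filling pair: for every finite presentation of $\Gamma_{4,3}$ there is a constant $C>0$ such that every null-homotopic word of length $n$ admits a filling of area at most $Cn^3$ and diameter at most $Cn$. Moreover, the Dehn function of $\Gamma_{4,3}$ is cubic: $\delta(n)\asymp n^3$ for every finite presentation of $\Gamma_{4,3}$. -/

import Mathlib

namespace CentralProductDehn

/-! ### The groups -/

/-- The group commutator in the convention `[g, h] = g⁻¹ h⁻¹ g h`. -/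
def groupComm {G : Type*} [Group G] (g h : G) : G := g⁻¹ * h⁻¹ * g * h

/-- Defining relators of the filiform lattice `Λ_p` on generators `x_1, …, x_p`, where the index
`i : Fin p` stands for the generator `x_{i+1}`:
`[x_1, x_j] = x_{j+1}` for `2 ≤ j ≤ p - 1`, `[x_i, x_j] = 1` for `2 ≤ i, j ≤ p`, and
`[x_1, x_p] = 1`. -/
def filiformRels (p : ℕ) : Set (FreeGroup (Fin p)) :=
  {r | ∃ a j k : Fin p, a.val = 0 ∧ 1 ≤ j.val ∧ k.val = j.val + 1 ∧
      r = groupComm (FreeGroup.of a) (FreeGroup.of j) * (FreeGroup.of k)⁻¹} ∪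
  {r | ∃ i j : Fin p, 1 ≤ i.val ∧ 1 ≤ j.val ∧
      r = groupComm (FreeGroup.of i) (FreeGroup.of j)} ∪
  {r | ∃ a l : Fin p, a.val = 0 ∧ l.val + 1 = p ∧
      r = groupComm (FreeGroup.of a) (FreeGroup.of l)}

/-- The lattice `Λ_p ≅ ℤ^{p-1} ⋊ ℤ` in the model filiform Lie group of dimension `p`. -/
abbrev Filiform (p : ℕ) : Type := PresentedGroup (filiformRels p)

/-- The last generator `z = x_p` of `Λ_p`; for `p ≥ 3` it generates the centre. -/
def filiformZ (p : ℕ) [NeZero p] : Filiform p :=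
  PresentedGroup.of ⟨p - 1, Nat.sub_lt (NeZero.pos p) Nat.one_pos⟩

/-- The central product of `K` and `L` obtained by identifying the central element `z` of `K` with
the central element `z'` of `L`: the quotient of `K × L` by the subgroup generated by
`(z, z'⁻¹)`. (For central `z`, `z'` that cyclic subgroup is its own normal closure.) -/
abbrev CentralProduct {K L : Type*} [Group K] [Group L] (z : K) (z' : L) :=
  (K × L) ⧸ Subgroup.normalClosure ({(z, z'⁻¹)} : Set (K × L))

/-- The lattice `Γ_{p,q}`: the central product of `Λ_p` and `Λ_q` along their centres. -/
abbrev Gamma (p q : ℕ) [NeZero p] [NeZero q] : Type :=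
  CentralProduct (filiformZ p) (filiformZ q)

/-! ### Finite presentations, fillings, filling pairs and Dehn functions -/

/-- `⟨s_0, …, s_{k-1} ∣ R⟩` is a finite presentation of the group `G`. -/
structure IsFinitePresentation {G : Type*} [Group G] {k : ℕ} (s : Fin k → G)
    (R : Set (FreeGroup (Fin k))) : Prop where
  surjective : Function.Surjective (FreeGroup.lift s)
  finite : R.Finite
  ker_eq : (FreeGroup.lift s).ker = Subgroup.normalClosure R

/-- `F = [(u_1, r_1), …, (u_a, r_a)]` is a filling of `w` over the relators `R`: every `r_i` lies
in `R^{±1}`, and `w = ∏ u_i⁻¹ r_i u_i` in the free group. Its area is `F.length`. -/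
def IsFilling {k : ℕ} (R : Set (FreeGroup (Fin k))) (w : FreeGroup (Fin k))
    (F : List (FreeGroup (Fin k) × FreeGroup (Fin k))) : Prop :=
  (∀ c ∈ F, c.2 ∈ R ∨ c.2⁻¹ ∈ R) ∧ w = (F.map fun c => c.1⁻¹ * c.2 * c.1).prod

/-- `G` admits `(f, g)` as a filling pair: `G` is finitely presented and, for every finite
presentation, every null-homotopic word of length `n` has a filling of area `O(f n)` all of whose
conjugating words have length `O(g n)`. The length of an element of the free group is the length of
its reduced word. -/
def AdmitsFillingPair (G : Type*) [Group G] (f g : ℝ → ℝ) : Prop :=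
  Group.IsFinitelyPresented G ∧
  ∀ (k : ℕ) (s : Fin k → G) (R : Set (FreeGroup (Fin k))), IsFinitePresentation s R →
    ∃ C : ℝ, 0 < C ∧ ∀ w : FreeGroup (Fin k), FreeGroup.lift s w = 1 →
      ∃ F : List (FreeGroup (Fin k) × FreeGroup (Fin k)), IsFilling R w F ∧
        (F.length : ℝ) ≤ C * f w.norm ∧ ∀ c ∈ F, (c.1.norm : ℝ) ≤ C * g w.norm

/-- The area of `w` over the relators `R`: the least area of a filling (`⊤` if there is none). -/
noncomputable def area {k : ℕ} (R : Set (FreeGroup (Fin k))) (w : FreeGroup (Fin k)) : ℕ∞ :=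
  ⨅ (F : List (FreeGroup (Fin k) × FreeGroup (Fin k))) (_ : IsFilling R w F), (F.length : ℕ∞)

/-- The Dehn function of the presentation with relators `R`: the supremum of the areas of the
null-homotopic words of length at most `n`. -/
noncomputable def dehn {k : ℕ} (R : Set (FreeGroup (Fin k))) (n : ℕ) : ℕ∞ :=
  ⨆ (w : FreeGroup (Fin k)) (_ : w ∈ Subgroup.normalClosure R ∧ w.norm ≤ n), area R w

/-- `f ≼ g`: there is `A` with `f n ≤ A * g (A * n + A) + A` for all `n`. -/
def AsympLE (f g : ℕ → ℕ∞) : Prop :=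
  ∃ A : ℕ, ∀ n : ℕ, f n ≤ (A : ℕ∞) * g (A * n + A) + (A : ℕ∞)

/-- `f ≍ g`: both `f ≼ g` and `g ≼ f`. -/
def AsympEq (f g : ℕ → ℕ∞) : Prop := AsympLE f g ∧ AsympLE g f

end CentralProductDehn

open CentralProductDehn

/-!
The upper bound is a rewriting argument. Fix a presentation. Families of words of length `O(n)`,
modulo families with fillings of area `O(n²)` and diameter `O(n)`, form a group `Asy R n`, so that a
uniform quadratic filling estimate is an equation in a group. Powers `g ^ e` with an exponent
`e = O(n)` define elements `pw hP g e` of it, and these commute whenever the group elements do.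

With generators `a ^ x = a b`, `b ^ x = b z`, `v ^ u = v z` (all other pairs commuting), the
elements `b v⁻¹` and `x u` of the five-dimensional Heisenberg group `⟨b, x, v, u⟩` commute, so
`[b ^ e, x ^ f] = [v ^ e, u ^ f]` in the asymptotic group. This element `zComm e f` stands for
`z ^ (e f)`; it is central because it can be written in two ways, and it is biadditive. The same
play with commuting pairs determines the failure of `(x b⁻¹) ^ e = x ^ e b ^ (-e)`, a central
element that stands for `z ^ (-e (e - 1) / 2)` (`zDefect_mul_self`). Consequently, with one letter `a` and
`e = n`, the first and second differences of `a` under conjugation by `x ^ n` are `b ^ (2 n)` and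
`z ^ (n ²)` up to explicit corrections (`pw_b_two_scale`, `zComm_scale_eq`), whereas two long
conjugates of powers of `a` never have to be commuted.

Hence each element of a ball of radius `O(n)` has a normal form word of length `O(n)`, in which
`b ^ (2 n)`, `z ^ n` and `[v ^ n, u ^ n]` are carried to shorter expressions, and right
multiplication by a letter followed by the carries costs area `O(n²)` at diameter `O(n)`. A
null-homotopic word of length `n` is consumed in `n` steps, for a total area of `O(n³)`
(`exists_nf_of_word`); the normal form that remains has trivial value in a polynomial model of the
group, and collapses at quadratic cost (`exists_near_one_of_eval`).

For the lower bound, `a ↦ x`, `x ↦ a` defines a homomorphism from the group to the quotient of the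
model by a central subgroup `ℤ`. Lifting it to a homomorphism from the free group, every relator
goes to a central element of bounded size, so a word of area `A` goes to a central element of size
`O(A)`. The relation that `a ^ n` commutes with its conjugate by `x ^ n` has length `O(n)` and goes to a
central element of size `2 n³` (`cubic_asympLE_dehn`).
-/

namespace CentralProductDehn

/-! ### Fillings with bounded area and diameter -/

section Fillable

variable {k : ℕ} {R : Set (FreeGroup (Fin k))}

/-- The word `w` has a filling of area at most `N` and diameter at most `D`. -/
def Fillable (R : Set (FreeGroup (Fin k))) (N D : ℕ) (w : FreeGroup (Fin k)) : Prop :=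
  ∃ F, IsFilling R w F ∧ F.length ≤ N ∧ ∀ c ∈ F, c.1.norm ≤ D

theorem Fillable.mono {N N' D D' : ℕ} {w : FreeGroup (Fin k)} (h : Fillable R N D w)
    (hN : N ≤ N') (hD : D ≤ D') : Fillable R N' D' w := by
  obtain ⟨F, h1, h2, h3⟩ := h
  exact ⟨F, h1, h2.trans hN, fun c hc => (h3 c hc).trans hD⟩

theorem Fillable.one (N D : ℕ) : Fillable R N D 1 :=
  ⟨[], ⟨by simp, by simp⟩, by simp, by simp⟩

theorem Fillable.mul {N N' D : ℕ} {w w' : FreeGroup (Fin k)} (h : Fillable R N D w)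
    (h' : Fillable R N' D w') : Fillable R (N + N') D (w * w') := by
  obtain ⟨F, ⟨h1, h2⟩, h3, h4⟩ := h
  obtain ⟨F', ⟨h1', h2'⟩, h3', h4'⟩ := h'
  refine ⟨F ++ F', ⟨?_, ?_⟩, ?_, ?_⟩
  · intro c hc
    rcases List.mem_append.1 hc with hc | hc
    exacts [h1 c hc, h1' c hc]
  · rw [List.map_append, List.prod_append, ← h2, ← h2']
  · rw [List.length_append]; omega
  · intro c hc
    rcases List.mem_append.1 hc with hc | hc
    exacts [h4 c hc, h4' c hc]

theorem Fillable.inv {N D : ℕ} {w : FreeGroup (Fin k)} (h : Fillable R N D w) :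
    Fillable R N D w⁻¹ := by
  obtain ⟨F, ⟨h1, h2⟩, h3, h4⟩ := h
  refine ⟨(F.map fun c => (c.1, c.2⁻¹)).reverse, ⟨?_, ?_⟩, by simpa using h3, ?_⟩
  · intro c hc
    simp only [List.mem_reverse, List.mem_map] at hc
    obtain ⟨d, hd, rfl⟩ := hc
    simpa [or_comm] using h1 d hd
  · rw [h2, List.prod_inv_reverse, List.map_reverse, List.map_map, List.map_map]
    congr 2
    apply List.map_congr_left
    intro c _
    simp [mul_assoc]
  · intro c hc
    simp only [List.mem_reverse, List.mem_map] at hc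
    obtain ⟨d, hd, rfl⟩ := hc
    exact h4 d hd

theorem Fillable.conj {N D : ℕ} {w : FreeGroup (Fin k)} (h : Fillable R N D w)
    (g : FreeGroup (Fin k)) : Fillable R N (D + g.norm) (g * w * g⁻¹) := by
  obtain ⟨F, ⟨h1, h2⟩, h3, h4⟩ := h
  refine ⟨F.map fun c => (c.1 * g⁻¹, c.2), ⟨?_, ?_⟩, by simpa using h3, ?_⟩
  · intro c hc
    simp only [List.mem_map] at hc
    obtain ⟨d, hd, rfl⟩ := hc
    exact h1 d hd
  · rw [h2, ← MulAut.conj_apply, map_list_prod, List.map_map, List.map_map]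
    congr 1
    apply List.map_congr_left
    intro c _
    simp [mul_assoc]
  · intro c hc
    simp only [List.mem_map] at hc
    obtain ⟨d, hd, rfl⟩ := hc
    have h5 := FreeGroup.norm_mul_le d.1 g⁻¹
    rw [FreeGroup.norm_inv_eq] at h5
    have := h4 d hd
    simp only
    omega

theorem exists_fillable_of_mem_normalClosure {w : FreeGroup (Fin k)}
    (hw : w ∈ Subgroup.normalClosure R) : ∃ C, Fillable R C C w := by
  induction hw using Subgroup.closure_induction with
  | mem w hw =>
    obtain ⟨r, hr, hc⟩ := Group.mem_conjugatesOfSet_iff.1 hw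
    obtain ⟨g, rfl⟩ := isConj_iff.1 hc
    have h1 : Fillable R 1 0 r := ⟨[(1, r)], ⟨by simp [hr], by simp⟩, by simp, by simp⟩
    exact ⟨_, (h1.conj g).mono (le_max_left 1 (0 + g.norm)) (le_max_right _ _)⟩
  | one => exact ⟨0, Fillable.one _ _⟩
  | mul w w' _ _ h h' =>
    obtain ⟨C, h⟩ := h
    obtain ⟨C', h'⟩ := h'
    exact ⟨C + C', (h.mono le_rfl (by omega)).mul (h'.mono le_rfl (by omega))⟩
  | inv w _ h =>
    obtain ⟨C, h⟩ := h
    exact ⟨C, h.inv⟩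

/-- `w` can be turned into `w'` by at most `N` applications of relators, each of them preceded by
a prefix of length at most `D`. -/
def Near (R : Set (FreeGroup (Fin k))) (N D : ℕ) (w w' : FreeGroup (Fin k)) : Prop :=
  Fillable R N D (w * w'⁻¹)

variable {N N' D D' m : ℕ} {g h w w' w'' : FreeGroup (Fin k)}

theorem Near.mono (h : Near R N D w w') (hN : N ≤ N') (hD : D ≤ D') : Near R N' D' w w' :=
  Fillable.mono h hN hD

theorem Near.refl (w : FreeGroup (Fin k)) : Near R N D w w := by
  simpa [Near] using Fillable.one N D

theorem Near.symm (h : Near R N D w w') : Near R N D w' w := by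
  simpa [Near] using Fillable.inv h

theorem Near.trans (h : Near R N D w w') (h' : Near R N' D w' w'') :
    Near R (N + N') D w w'' := by
  have := Fillable.mul h h'
  simpa [Near, mul_assoc] using this

theorem Near.mul_right (h : Near R N D w w') (c : FreeGroup (Fin k)) :
    Near R N D (w * c) (w' * c) := by
  simpa [Near, mul_assoc] using h

theorem Near.mul_left (h : Near R N D w w') (c : FreeGroup (Fin k)) :
    Near R N (D + c.norm) (c * w) (c * w') := by
  simpa [Near, mul_assoc] using Fillable.conj h c

theorem norm_pow_le (g : FreeGroup (Fin k)) (m : ℕ) : (g ^ m).norm ≤ m * g.norm := by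
  induction m with
  | zero => simp
  | succ m ih =>
    rw [pow_succ, add_mul, one_mul]
    exact (FreeGroup.norm_mul_le _ _).trans (by omega)

theorem norm_zpow_le (g : FreeGroup (Fin k)) (e : ℤ) : (g ^ e).norm ≤ e.natAbs * g.norm := by
  obtain ⟨m, rfl | rfl⟩ := e.eq_nat_or_neg
  · simpa using norm_pow_le g m
  · simpa using norm_pow_le g m

theorem Near.pow (hgh : Near R N D g h) (m : ℕ) :
    Near R (m * N) (D + m * g.norm) (g ^ m) (h ^ m) := by
  induction m with
  | zero => simpa using Near.refl _
  | succ m ih =>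
    have h1 := hgh.mul_left (g ^ m)
    have h2 := (ih.mul_right h)
    rw [← pow_succ] at h1 h2
    have h3 := norm_pow_le g m
    rw [add_mul, add_mul, one_mul, one_mul, add_comm (m * N)]
    exact (h1.mono le_rfl (by omega)).trans (h2.mono le_rfl (by omega))

theorem Near.pow_right_comm (hgh : Near R N D (g * h) (h * g)) (m : ℕ) :
    Near R (m * N) (D + m * h.norm) (g * h ^ m) (h ^ m * g) := by
  induction m with
  | zero => simpa using Near.refl _
  | succ m ih =>
    have h1 := ih.mul_right h
    have h2 := hgh.mul_left (h ^ m)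
    have h3 := norm_pow_le h m
    rw [add_mul, add_mul, one_mul, one_mul, pow_succ, ← mul_assoc, mul_assoc _ h g]
    rw [mul_assoc _ g h] at h1
    exact (h1.mono le_rfl (by omega)).trans (h2.mono le_rfl (by omega))

theorem Near.pow_pow_comm (hgh : Near R N D (g * h) (h * g)) (l m : ℕ) :
    Near R (l * (m * N)) (D + m * h.norm + l * g.norm) (g ^ l * h ^ m) (h ^ m * g ^ l) :=
  ((hgh.pow_right_comm m).symm.pow_right_comm l).symm

theorem Near.mul_pow (hgh : Near R N D (g * h) (h * g)) (m : ℕ) :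
    Near R (m * (m * N)) (D + m * g.norm + m * h.norm) ((g * h) ^ m) (g ^ m * h ^ m) := by
  induction m with
  | zero => simpa using Near.refl _
  | succ m ih =>
    have h1 := ih.mul_right (g * h)
    have h2 := ((hgh.pow_right_comm m).symm.mul_left (g ^ m)).mul_right h
    have h3 := norm_pow_le g m
    rw [← pow_succ] at h1
    have e1 : g ^ m * (h ^ m * g) * h = g ^ m * h ^ m * (g * h) := by group
    have e2 : g ^ m * (g * h ^ m) * h = g ^ (m + 1) * h ^ (m + 1) := by
      simp only [pow_succ, mul_assoc]
    rw [e1, e2] at h2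
    refine ((h1.mono le_rfl ?_).trans (h2.mono le_rfl ?_)).mono ?_ le_rfl
    · nlinarith
    · nlinarith
    · nlinarith

end Fillable

/-! ### The asymptotic group of a presentation -/

section Asymptotic

variable {k : ℕ} {R : Set (FreeGroup (Fin k))} {ι : Type*}

/-- The families of words whose length is at most linear in the scale `n`. -/
def linFam (k : ℕ) (n : ι → ℕ+) : Subgroup (ι → FreeGroup (Fin k)) where
  carrier := {w | ∃ C : ℕ, ∀ i, (w i).norm ≤ C * n i}
  one_mem' := ⟨0, by simp⟩
  mul_mem' := by
    rintro w w' ⟨C, h⟩ ⟨C', h'⟩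
    refine ⟨C + C', fun i => (FreeGroup.norm_mul_le _ _).trans ?_⟩
    rw [add_mul]
    exact add_le_add (h i) (h' i)
  inv_mem' := by
    rintro w ⟨C, h⟩
    exact ⟨C, by simpa using h⟩

/-- The families of words of linear length that have fillings of quadratic area and linear
diameter in terms of the scale `n`. -/
def quadFam (R : Set (FreeGroup (Fin k))) (n : ι → ℕ+) : Subgroup (linFam k n) where
  carrier := {w | ∃ C : ℕ, ∀ i, Fillable R (C * n i ^ 2) (C * n i) (w.1 i)}
  one_mem' := ⟨0, fun i => Fillable.one _ _⟩
  mul_mem' := by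
    rintro w w' ⟨C, h⟩ ⟨C', h'⟩
    refine ⟨C + C', fun i => ?_⟩
    rw [add_mul]
    exact ((h i).mono le_rfl (by gcongr; omega)).mul ((h' i).mono le_rfl (by gcongr; omega))
  inv_mem' := by
    rintro w ⟨C, h⟩
    exact ⟨C, fun i => (h i).inv⟩

instance quadFam_normal (n : ι → ℕ+) : (quadFam R n).Normal where
  conj_mem := by
    rintro w ⟨C, h⟩ ⟨g, C', h'⟩
    refine ⟨C + C', fun i => ((h i).conj (g i)).mono ?_ ?_⟩
    · gcongr; omega
    · have := h' i
      rw [add_mul]; omega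

/-- Families of words of linear length up to quadratic area and linear diameter. Equations in this
group are filling estimates that hold uniformly in the index. -/
abbrev Asy (R : Set (FreeGroup (Fin k))) (n : ι → ℕ+) := linFam k n ⧸ quadFam R n

theorem asy_eq_iff {n : ι → ℕ+} {w w' : linFam k n} :
    (w : Asy R n) = w' ↔
      ∃ C : ℕ, ∀ i, Near R (C * n i ^ 2) (C * n i) (w.1 i) (w'.1 i) := by
  rw [QuotientGroup.eq_iff_div_mem, div_eq_mul_inv]
  rfl

/-- Families of integers bounded linearly in the scale `n`. -/
def linExp (n : ι → ℕ+) : AddSubgroup (ι → ℤ) where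
  carrier := {e | ∃ C : ℕ, ∀ i, (e i).natAbs ≤ C * n i}
  zero_mem' := ⟨0, by simp⟩
  add_mem' := by
    rintro e f ⟨C, h⟩ ⟨C', h'⟩
    refine ⟨C + C', fun i => ?_⟩
    have h1 := h i
    have h2 := h' i
    rw [add_mul]
    simp only [Pi.add_apply]
    omega
  neg_mem' := by
    rintro e ⟨C, h⟩
    exact ⟨C, by simpa using h⟩

/-- A constant exponent. -/
def constExp (n : ι → ℕ+) (t : ℤ) : linExp n :=
  ⟨fun _ => t, t.natAbs, fun i => Nat.le_mul_of_pos_right _ (n i).pos⟩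

/-- The scale itself as an exponent. -/
def scaleExp (n : ι → ℕ+) : linExp n := ⟨fun i => (n i : ℕ), 1, fun i => by simp⟩

theorem zpow_mem_linFam {n : ι → ℕ+} (g : FreeGroup (Fin k)) (e : linExp n) :
    (fun i => g ^ e.1 i) ∈ linFam k n := by
  obtain ⟨C, h⟩ := e.2
  refine ⟨C * g.norm, fun i => (norm_zpow_le _ _).trans ?_⟩
  calc _ ≤ C * n i * g.norm := Nat.mul_le_mul_right _ (h i)
    _ = _ := by ring

/-- The class of the family of powers of a fixed word. -/
def wordPow (R : Set (FreeGroup (Fin k))) {n : ι → ℕ+} (g : FreeGroup (Fin k)) (e : linExp n) :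
    Asy R n :=
  ((⟨_, zpow_mem_linFam g e⟩ : linFam k n) : Asy R n)

theorem wordPow_add {n : ι → ℕ+} (g : FreeGroup (Fin k)) (e f : linExp n) :
    wordPow R g (e + f) = wordPow R g e * wordPow R g f := by
  unfold wordPow
  rw [← QuotientGroup.mk_mul]
  congr 2
  funext i
  exact zpow_add g _ _

variable {G : Type*} [Group G] {s : Fin k → G}

theorem exists_near (hP : IsFinitePresentation s R) {g h : FreeGroup (Fin k)}
    (hgh : FreeGroup.lift s g = FreeGroup.lift s h) : ∃ C, Near R C C g h := by
  apply exists_fillable_of_mem_normalClosure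
  rw [← hP.ker_eq, MonoidHom.mem_ker]
  simp [hgh]

/-- Two words for the same group element have powers that agree up to quadratic area: each factor
is exchanged at bounded cost. -/
theorem wordPow_congr (hP : IsFinitePresentation s R) {n : ι → ℕ+} {g h : FreeGroup (Fin k)}
    (hgh : FreeGroup.lift s g = FreeGroup.lift s h) (e : linExp n) :
    wordPow R g e = wordPow R h e := by
  obtain ⟨C, hC⟩ := exists_near hP hgh
  obtain ⟨C', hC'⟩ := exists_near hP (g := g⁻¹) (h := h⁻¹) (by simp [hgh])
  obtain ⟨A, hA⟩ := e.2
  refine asy_eq_iff.2 ⟨A * (C + C') + (C + C') + A * g.norm, fun i => ?_⟩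
  have h0 : 1 ≤ (n i : ℕ) := (n i).pos
  have key : ∀ g' h' : FreeGroup (Fin k), g'.norm = g.norm → Near R (C + C') (C + C') g' h' →
      Near R ((A * (C + C') + (C + C') + A * g.norm) * n i ^ 2)
        ((A * (C + C') + (C + C') + A * g.norm) * n i)
        (g' ^ (e.1 i).natAbs) (h' ^ (e.1 i).natAbs) := by
    intro g' h' hn hh
    refine (hh.pow _).mono ?_ ?_
    · calc _ ≤ A * n i * (C + C') := Nat.mul_le_mul_right _ (hA i)
        _ = A * (C + C') * n i := by ring
        _ ≤ A * (C + C') * n i ^ 2 := by gcongr; nlinarith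
        _ ≤ _ := Nat.mul_le_mul_right _ (by omega)
    · rw [hn]
      calc _ ≤ (C + C') * n i + A * n i * g.norm := by
            gcongr
            · nlinarith
            · exact hA i
        _ = ((C + C') + A * g.norm) * n i := by ring
        _ ≤ _ := Nat.mul_le_mul_right _ (by omega)
  simp only
  rcases Int.natAbs_eq (e.1 i) with hi | hi
  · rw [hi, zpow_natCast, zpow_natCast]
    exact key g h rfl (hC.mono (by omega) (by omega))
  · rw [hi, zpow_neg, zpow_neg, zpow_natCast, zpow_natCast, ← inv_pow, ← inv_pow]
    exact key _ _ FreeGroup.norm_inv_eq (hC'.mono (by omega) (by omega))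

/-- Powers of commuting elements commute up to quadratic area, since the van Kampen diagram is a
grid. -/
theorem wordPow_commute (hP : IsFinitePresentation s R) {n : ι → ℕ+} {g h : FreeGroup (Fin k)}
    (hgh : Commute (FreeGroup.lift s g) (FreeGroup.lift s h)) (e f : linExp n) :
    Commute (wordPow R g e) (wordPow R h f) := by
  have hex : ∀ g' h' : FreeGroup (Fin k), Commute (FreeGroup.lift s g') (FreeGroup.lift s h') →
      ∃ C, Near R C C (g' * h') (h' * g') := fun g' h' hc =>
    exists_near hP (by simpa using hc.eq)
  obtain ⟨C₁, hC₁⟩ := hex g h hgh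
  obtain ⟨C₂, hC₂⟩ := hex g h⁻¹ (by simpa using hgh)
  obtain ⟨C₃, hC₃⟩ := hex g⁻¹ h (by simpa using hgh)
  obtain ⟨C₄, hC₄⟩ := hex g⁻¹ h⁻¹ (by simpa using hgh)
  obtain ⟨A, hA⟩ := e.2
  obtain ⟨B, hB⟩ := f.2
  set C := C₁ + C₂ + C₃ + C₄ with hC
  refine (QuotientGroup.mk_mul _ _ _).symm.trans (Eq.trans ?_ (QuotientGroup.mk_mul _ _ _))
  refine asy_eq_iff.2 ⟨A * B * C + C + B * h.norm + A * g.norm, fun i => ?_⟩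
  have h0 : 1 ≤ (n i : ℕ) := (n i).pos
  have key : ∀ g' h' : FreeGroup (Fin k), g'.norm = g.norm → h'.norm = h.norm →
      Near R C C (g' * h') (h' * g') →
      Near R ((A * B * C + C + B * h.norm + A * g.norm) * n i ^ 2)
        ((A * B * C + C + B * h.norm + A * g.norm) * n i)
        (g' ^ (e.1 i).natAbs * h' ^ (f.1 i).natAbs)
        (h' ^ (f.1 i).natAbs * g' ^ (e.1 i).natAbs) := by
    intro g' h' hg hh' hh
    refine (hh.pow_pow_comm _ _).mono ?_ ?_
    · calc _ ≤ A * n i * (B * n i * C) := by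
            gcongr
            · exact hA i
            · exact hB i
        _ = A * B * C * n i ^ 2 := by ring
        _ ≤ _ := Nat.mul_le_mul_right _ (by omega)
    · rw [hg, hh']
      calc _ ≤ C * n i + B * n i * h.norm + A * n i * g.norm := by
            gcongr
            · nlinarith
            · exact hB i
            · exact hA i
        _ = (C + B * h.norm + A * g.norm) * n i := by ring
        _ ≤ _ := Nat.mul_le_mul_right _ (by omega)
  change Near R _ _ (g ^ e.1 i * h ^ f.1 i) (h ^ f.1 i * g ^ e.1 i)
  rcases Int.natAbs_eq (e.1 i) with hi | hi <;> rcases Int.natAbs_eq (f.1 i) with hj | hj <;>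
    rw [hi, hj] <;> simp only [zpow_neg, zpow_natCast, ← inv_pow]
  · exact key g h rfl rfl (hC₁.mono (by omega) (by omega))
  · exact key g h⁻¹ rfl FreeGroup.norm_inv_eq (hC₂.mono (by omega) (by omega))
  · exact key g⁻¹ h FreeGroup.norm_inv_eq rfl (hC₃.mono (by omega) (by omega))
  · exact key g⁻¹ h⁻¹ FreeGroup.norm_inv_eq FreeGroup.norm_inv_eq
      (hC₄.mono (by omega) (by omega))

/-- Sorting the factors of `(g h) ^ e` takes quadratically many exchanges. -/
theorem wordPow_mul (hP : IsFinitePresentation s R) {n : ι → ℕ+} {g h : FreeGroup (Fin k)}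
    (hgh : Commute (FreeGroup.lift s g) (FreeGroup.lift s h)) (e : linExp n) :
    wordPow R (g * h) e = wordPow R g e * wordPow R h e := by
  have hex : ∀ g' h' : FreeGroup (Fin k), Commute (FreeGroup.lift s g') (FreeGroup.lift s h') →
      ∃ C, Near R C C (g' * h') (h' * g') := fun g' h' hc =>
    exists_near hP (by simpa using hc.eq)
  -- Reversing the factors first makes the positive powers match `Near.mul_pow`; the negative powers
  -- then come with the factors `g⁻¹, h⁻¹` in the order `g, h` and are sorted with `hB`.
  rw [wordPow_congr hP (g := g * h) (h := h * g) (by simpa using hgh.eq)]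
  refine Eq.trans ?_ (wordPow_commute hP hgh e e).eq.symm
  obtain ⟨C₁, hC₁⟩ := hex h g hgh.symm
  obtain ⟨C₂, hC₂⟩ := hex g⁻¹ h⁻¹ (by simpa using hgh)
  obtain ⟨A, hA⟩ := e.2
  set C := C₁ + C₂ with hC
  have hcomm := wordPow_commute hP hgh e e
  refine Eq.trans ?_ (QuotientGroup.mk_mul _ _ _)
  obtain ⟨B, hB⟩ := asy_eq_iff.1 ((QuotientGroup.mk_mul _ _ _).trans
    (hcomm.eq.trans (QuotientGroup.mk_mul _ _ _).symm))
  refine asy_eq_iff.2 ⟨A * A * C + C + A * h.norm + A * g.norm + B, fun i => ?_⟩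
  have h0 : 1 ≤ (n i : ℕ) := (n i).pos
  have key : ∀ g' h' : FreeGroup (Fin k), g'.norm + h'.norm = h.norm + g.norm →
      Near R C C (g' * h') (h' * g') →
      Near R ((A * A * C + C + A * h.norm + A * g.norm) * n i ^ 2)
        ((A * A * C + C + A * h.norm + A * g.norm + B) * n i)
        ((g' * h') ^ (e.1 i).natAbs) (g' ^ (e.1 i).natAbs * h' ^ (e.1 i).natAbs) := by
    intro g' h' hg hh
    refine (hh.mul_pow _).mono ?_ ?_
    · calc _ ≤ A * n i * (A * n i * C) := by
            gcongr
            · exact hA i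
            · exact hA i
        _ = A * A * C * n i ^ 2 := by ring
        _ ≤ _ := Nat.mul_le_mul_right _ (by omega)
    · calc _ = C + (e.1 i).natAbs * (g'.norm + h'.norm) := by ring
        _ ≤ C * n i + A * n i * (g'.norm + h'.norm) := by
            gcongr
            · nlinarith
            · exact hA i
        _ = (C + A * h.norm + A * g.norm) * n i := by rw [hg]; ring
        _ ≤ _ := Nat.mul_le_mul_right _ (by omega)
  change Near R _ _ ((h * g) ^ e.1 i) (h ^ e.1 i * g ^ e.1 i)
  rcases Int.natAbs_eq (e.1 i) with hi | hi
  · rw [hi]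
    simp only [zpow_natCast]
    exact (key h g rfl (hC₁.mono (by omega) (by omega))).mono
      (Nat.mul_le_mul_right _ (by omega)) le_rfl
  · have h1 := key g⁻¹ h⁻¹ (by simp [add_comm]) (hC₂.mono (by omega) (by omega))
    have h2 : Near R (B * n i ^ 2) (B * n i) (g ^ e.1 i * h ^ e.1 i) (h ^ e.1 i * g ^ e.1 i) := hB i
    have e1 : (g⁻¹ * h⁻¹) ^ (e.1 i).natAbs = (h * g) ^ e.1 i := by
      rw [← mul_inv_rev, inv_pow, ← zpow_natCast, ← zpow_neg, ← hi]
    have e2 : g⁻¹ ^ (e.1 i).natAbs * h⁻¹ ^ (e.1 i).natAbs = g ^ e.1 i * h ^ e.1 i := by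
      rw [inv_pow, inv_pow, ← zpow_natCast, ← zpow_natCast, ← zpow_neg, ← zpow_neg, ← hi]
    rw [e1, e2] at h1
    refine (h1.trans (h2.mono le_rfl ?_)).mono (by rw [← add_mul]) le_rfl
    exact Nat.mul_le_mul_right _ (by omega)

/-- The class in the asymptotic group of the powers `g ^ e`, where `g` is an element of the
presented group, written as a fixed word, and the exponent `e` is linear in the scale. -/
noncomputable def pw (hP : IsFinitePresentation s R) {n : ι → ℕ+} (g : G) (e : linExp n) :
    Asy R n :=
  wordPow R (Function.surjInv hP.surjective g) e

variable (hP : IsFinitePresentation s R) {n : ι → ℕ+}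
include hP

theorem lift_surjInv (g : G) : FreeGroup.lift s (Function.surjInv hP.surjective g) = g :=
  Function.surjInv_eq hP.surjective g

theorem pw_add (g : G) (e f : linExp n) : pw hP g (e + f) = pw hP g e * pw hP g f :=
  wordPow_add _ _ _

theorem pw_zero (g : G) : pw hP g (0 : linExp n) = 1 := by
  have := pw_add hP g (0 : linExp n) 0
  rwa [add_zero, left_eq_mul] at this

theorem pw_neg (g : G) (e : linExp n) : pw hP g (-e) = (pw hP g e)⁻¹ := by
  rw [eq_inv_iff_mul_eq_one, ← pw_add, neg_add_cancel, pw_zero]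

theorem pw_commute {g h : G} (hgh : Commute g h) (e f : linExp n) :
    Commute (pw hP g e) (pw hP h f) :=
  wordPow_commute hP (by simpa [lift_surjInv hP] using hgh) e f

theorem pw_mul {g h : G} (hgh : Commute g h) (e : linExp n) :
    pw hP (g * h) e = pw hP g e * pw hP h e := by
  refine Eq.trans ?_ (wordPow_mul hP (by simpa [lift_surjInv hP] using hgh) e)
  exact wordPow_congr hP (by simp [lift_surjInv hP]) e

theorem pw_one (e : linExp n) : pw hP (1 : G) e = 1 := by
  have := pw_mul hP (Commute.one_left (1 : G)) e
  rwa [mul_one, left_eq_mul] at this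

theorem pw_inv (g : G) (e : linExp n) : pw hP g⁻¹ e = (pw hP g e)⁻¹ := by
  rw [eq_inv_iff_mul_eq_one, ← pw_mul hP (Commute.inv_left (Commute.refl g)), inv_mul_cancel,
    pw_one]

/-- Moving a single letter across a power is free, because a conjugate of a power is the power of
the conjugate. -/
theorem pw_conj (g h : G) (e : linExp n) :
    pw hP g e * pw hP h (constExp n 1) = pw hP h (constExp n 1) * pw hP (h⁻¹ * g * h) e := by
  have h1 : pw hP (h⁻¹ * g * h) e = wordPow R ((Function.surjInv hP.surjective h)⁻¹ *
      Function.surjInv hP.surjective g * Function.surjInv hP.surjective h) e :=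
    wordPow_congr hP (by simp [lift_surjInv hP]) e
  rw [h1]
  refine (QuotientGroup.mk_mul _ _ _).symm.trans (Eq.trans ?_ (QuotientGroup.mk_mul _ _ _))
  refine congrArg _ (Subtype.ext (funext fun i => ?_))
  change Function.surjInv hP.surjective g ^ e.1 i * Function.surjInv hP.surjective h ^ (1 : ℤ) =
    Function.surjInv hP.surjective h ^ (1 : ℤ) * (_ * _ * _) ^ e.1 i
  have := conj_zpow (i := e.1 i) (a := (Function.surjInv hP.surjective h)⁻¹)
    (b := Function.surjInv hP.surjective g)
  rw [inv_inv] at this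
  rw [this]
  simp [mul_assoc]

end Asymptotic

/-! ### Generators of the central product -/

/-- Generators `x, a, b, z, u, v` with `a ^ x = a b`, `b ^ x = b z`, `v ^ u = v z`, all other pairs
of generators commuting. In `Γ_{4,3}` one takes `x = x_1⁻¹`, `a = x_2`, `u = y_1⁻¹`, `v = y_2`. -/
structure Frame (G : Type*) [Group G] where
  /-- acts on `a` and `b` -/
  x : G
  /-- top generator of the filiform factor -/
  a : G
  /-- middle generator of the filiform factor -/
  b : G
  /-- generator of the centre -/
  z : G
  /-- acts on `v` -/
  u : G
  /-- second generator of the Heisenberg factor -/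
  v : G
  a_x : a * x = x * a * b
  b_x : b * x = x * b * z
  v_u : v * u = u * v * z
  a_b : Commute a b
  a_z : Commute a z
  a_u : Commute a u
  a_v : Commute a v
  b_z : Commute b z
  b_u : Commute b u
  b_v : Commute b v
  x_z : Commute x z
  x_u : Commute x u
  x_v : Commute x v
  u_z : Commute u z
  v_z : Commute v z
  closure_eq : Subgroup.closure {x, a, b, z, u, v} = ⊤

/-! ### Relations in the asymptotic group -/

section GroupLemmas

variable {Q : Type*} [Group Q]

/-- If `B V⁻¹` and `X U` commute, and `B, X` commute with `V, U`, then the commutator of `B` and `X`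
is that of `V` and `U`. -/
theorem mul_eq_mul_comm_of_commute {B V X U : Q} (hBV : Commute B V) (hBU : Commute B U)
    (hXV : Commute X V) (hXU : Commute X U) (h : Commute (B * V⁻¹) (X * U)) :
    B * X = X * B * (V⁻¹ * U⁻¹ * V * U) := by
  have h1 : (X * B)⁻¹ * (B * X) = U * V⁻¹ * U⁻¹ * V := by
    have h2 : B * X * (V⁻¹ * U) = X * B * (U * V⁻¹) := by
      calc B * X * (V⁻¹ * U) = B * (X * V⁻¹) * U := by group
        _ = (B * V⁻¹) * (X * U) := by rw [hXV.inv_right.eq]; group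
        _ = (X * U) * (B * V⁻¹) := h.eq
        _ = X * (U * B) * V⁻¹ := by group
        _ = X * B * (U * V⁻¹) := by rw [← hBU.eq]; group
    calc (X * B)⁻¹ * (B * X) = (X * B)⁻¹ * (B * X * (V⁻¹ * U)) * (V⁻¹ * U)⁻¹ := by group
      _ = _ := by rw [h2]; group
  have hc : ∀ t, Commute B t → Commute X t → Commute (U * V⁻¹ * U⁻¹ * V) t := fun t hB hX => by
    rw [← h1]
    exact (hX.mul_left hB).inv_left.mul_left (hB.mul_left hX)
  have hcV := hc V hBV hXV
  have hcU := hc U hBU hXU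
  have h3 : V⁻¹ * U⁻¹ * V * U = U * V⁻¹ * U⁻¹ * V := by
    calc V⁻¹ * U⁻¹ * V * U = V⁻¹ * U⁻¹ * (V * (U * V⁻¹ * U⁻¹ * V)) * V⁻¹ * (U * V) := by group
      _ = V⁻¹ * (U⁻¹ * (U * V⁻¹ * U⁻¹ * V)) * U * V := by rw [← hcV.eq]; group
      _ = V⁻¹ * (U * V⁻¹ * U⁻¹ * V) * V := by rw [← hcU.inv_right.eq]; group
      _ = _ := by rw [← hcV.inv_right.eq]; group
  rw [h3, ← h1]
  group

/-- In a Heisenberg group of dimension five, the two commutators with value `Z` cancel in the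
commutator of the products. -/
theorem commute_mul_of_twisted {B V X U Z : Q} (hBU : Commute B U)
    (hXV : Commute X V) (hUZ : Commute U Z)
    (hBX : B * X = X * B * Z) (hVU : V * U = U * V * Z) : Commute (B * V⁻¹) (X * U) := by
  have h1 : V⁻¹ * U = U * Z⁻¹ * V⁻¹ := by
    calc V⁻¹ * U = V⁻¹ * (U * V * Z) * (Z⁻¹ * V⁻¹) := by group
      _ = U * (Z⁻¹ * V⁻¹) := by rw [← hVU]; group
      _ = _ := by group
  change B * V⁻¹ * (X * U) = X * U * (B * V⁻¹)
  calc B * V⁻¹ * (X * U) = B * (V⁻¹ * X) * U := by group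
    _ = B * X * (V⁻¹ * U) := by rw [← hXV.inv_right.eq]; group
    _ = X * B * (Z * U) * Z⁻¹ * V⁻¹ := by rw [h1, hBX]; group
    _ = X * (B * U) * V⁻¹ := by rw [← hUZ.eq]; group
    _ = _ := by rw [hBU.eq]; group

theorem mul_inv_comm_of_twisted {V U Z : Q} (hVZ : Commute V Z) (hVU : V * U = U * V * Z) :
    U * V⁻¹ = V⁻¹ * U * Z := by
  calc U * V⁻¹ = V⁻¹ * (V * U) * V⁻¹ := by group
    _ = V⁻¹ * U * (V * Z) * V⁻¹ := by rw [hVU]; group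
    _ = _ := by rw [hVZ.eq]; group

theorem inv_mul_inv_of_twisted {V U Z : Q} (hUZ : Commute U Z) (hVZ : Commute V Z)
    (hVU : V * U = U * V * Z) : V⁻¹ * U⁻¹ = U⁻¹ * V⁻¹ * Z := by
  calc V⁻¹ * U⁻¹ = (V * U * Z⁻¹)⁻¹ := by rw [hVU]; group
    _ = _ := by rw [((hVZ.mul_left hUZ).inv_right).eq]; group

theorem inv_mul_mul_inv_mul_eq_one {A A' B B' : Q} (hAA : Commute A A') (hBA : Commute B A')
    (h : B * B' = A * A') : A⁻¹ * B * (A'⁻¹ * B') = 1 := by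
  calc A⁻¹ * B * (A'⁻¹ * B') = A⁻¹ * (B * A'⁻¹) * B' := by group
    _ = A⁻¹ * A'⁻¹ * (B * B') := by rw [hBA.inv_right.eq]; group
    _ = A⁻¹ * (A'⁻¹ * A) * A' := by rw [h]; group
    _ = 1 := by rw [← hAA.inv_right.eq]; group

end GroupLemmas

section Algebra

variable {k : ℕ} {R : Set (FreeGroup (Fin k))} {ι : Type*} {G : Type*} [Group G] {s : Fin k → G}
  (hP : IsFinitePresentation s R) {n : ι → ℕ+} (γ : Frame G)

/-- The defect of multiplicativity of `e`-th powers on the pair `g, h`. -/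
noncomputable def powDefect (g h : G) (e : linExp n) : Asy R n :=
  (pw hP g e * pw hP h e)⁻¹ * pw hP (g * h) e

include hP in
/-- If `g, h` commute with `g', h'`, and `g g'` commutes with `h h'`, both sides of
`(g h) (g' h') = (g g') (h h')` have computable powers, and so the two defects cancel. -/
theorem powDefect_mul_powDefect {g h g' h' : G} (hgg : Commute g g') (hgh : Commute g h')
    (hhg : Commute h g') (hhh : Commute h h') (hc : Commute (g * g') (h * h')) (e : linExp n) :
    powDefect hP g h e * powDefect hP g' h' e = 1 := by
  have h1 : pw hP (g * h) e * pw hP (g' * h') e =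
      pw hP g e * pw hP h e * (pw hP g' e * pw hP h' e) := by
    rw [← pw_mul hP ((hgg.mul_left hhg).mul_right (hgh.mul_left hhh)),
      show g * h * (g' * h') = g * g' * (h * h') by
        rw [mul_assoc, ← mul_assoc h, hhg.eq]; group,
      pw_mul hP hc, pw_mul hP hgg, pw_mul hP hhh, mul_assoc, mul_assoc, ← mul_assoc _ (pw hP h e),
      ← (pw_commute hP hhg e e).eq, mul_assoc]
  refine inv_mul_mul_inv_mul_eq_one ?_ ?_ h1
  · exact ((pw_commute hP hgg e e).mul_left (pw_commute hP hhg e e)).mul_right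
      ((pw_commute hP hgh e e).mul_left (pw_commute hP hhh e e))
  · exact (pw_commute hP (hgg.mul_left hhg) e e).mul_right (pw_commute hP (hgh.mul_left hhh) e e)

include hP in
theorem powDefect_mul_right {g h c : G} (hg : Commute g c) (hh : Commute h c) (e : linExp n) :
    powDefect hP g (h * c) e = powDefect hP g h e := by
  unfold powDefect
  rw [← mul_assoc g, pw_mul hP hh, pw_mul hP (hg.mul_left hh),
    (pw_commute hP (hg.mul_left hh) e e).eq, ← mul_assoc (pw hP g e),
    (((pw_commute hP hg e e).mul_left (pw_commute hP hh e e))).eq]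
  group

include hP in
theorem powDefect_mul_left {g h c : G} (hg : Commute g c) (hh : Commute h c) (e : linExp n) :
    powDefect hP (g * c) h e = powDefect hP g h e := by
  unfold powDefect
  rw [hg.eq, mul_assoc, pw_mul hP hg.symm, pw_mul hP (hg.symm.mul_right hh.symm)]
  group

/-- The commutator of `v ^ e` and `u ^ f`; it stands for `z ^ (e f)`. -/
noncomputable def zComm (e f : linExp n) : Asy R n :=
  (pw hP γ.v e)⁻¹ * (pw hP γ.u f)⁻¹ * pw hP γ.v e * pw hP γ.u f

theorem pw_v_mul_pw_u (e f : linExp n) :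
    pw hP γ.v e * pw hP γ.u f = pw hP γ.u f * pw hP γ.v e * zComm hP γ e f := by
  unfold zComm; group

theorem Frame.commute_bv_xu : Commute (γ.b * γ.v⁻¹) (γ.x * γ.u) :=
  commute_mul_of_twisted γ.b_u γ.x_v γ.u_z γ.b_x γ.v_u

/-- The commutator of `b ^ e` and `x ^ f` is that of `v ^ e` and `u ^ f`, since `b v⁻¹` and `x u`
commute. -/
theorem pw_b_mul_pw_x (e f : linExp n) :
    pw hP γ.b e * pw hP γ.x f = pw hP γ.x f * pw hP γ.b e * zComm hP γ e f := by
  refine mul_eq_mul_comm_of_commute (pw_commute hP γ.b_v e e) (pw_commute hP γ.b_u e f)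
    (pw_commute hP γ.x_v f e) (pw_commute hP γ.x_u f f) ?_
  rw [← pw_inv, ← pw_mul hP γ.b_v.inv_right, ← pw_mul hP γ.x_u]
  exact pw_commute hP γ.commute_bv_xu e f

theorem zComm_commute_of_v_u {e f : linExp n} {t : Asy R n} (hv : Commute (pw hP γ.v e) t)
    (hu : Commute (pw hP γ.u f) t) : Commute (zComm hP γ e f) t :=
  ((hv.inv_left.mul_left hu.inv_left).mul_left hv).mul_left hu

theorem zComm_commute_of_b_x {e f : linExp n} {t : Asy R n} (hb : Commute (pw hP γ.b e) t)
    (hx : Commute (pw hP γ.x f) t) : Commute (zComm hP γ e f) t := by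
  have : zComm hP γ e f = (pw hP γ.x f * pw hP γ.b e)⁻¹ * (pw hP γ.b e * pw hP γ.x f) := by
    rw [pw_b_mul_pw_x]; group
  rw [this]
  exact (hx.mul_left hb).inv_left.mul_left (hb.mul_left hx)

/-- `g` is one of the generators of the frame. -/
def Frame.IsGen (g : G) : Prop :=
  g = γ.x ∨ g = γ.a ∨ g = γ.b ∨ g = γ.z ∨ g = γ.u ∨ g = γ.v

/-- The element `zComm e f` is central: it commutes with whatever commutes with `u` and `v`, and
with whatever commutes with `b` and `x`. -/
theorem zComm_commute_pw (e f : linExp n) {g : G} (hg : γ.IsGen g) (t : linExp n) :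
    Commute (zComm hP γ e f) (pw hP g t) := by
  rcases hg with rfl | rfl | rfl | rfl | rfl | rfl
  · exact zComm_commute_of_v_u hP γ (pw_commute hP γ.x_v.symm _ _) (pw_commute hP γ.x_u.symm _ _)
  · exact zComm_commute_of_v_u hP γ (pw_commute hP γ.a_v.symm _ _) (pw_commute hP γ.a_u.symm _ _)
  · exact zComm_commute_of_v_u hP γ (pw_commute hP γ.b_v.symm _ _) (pw_commute hP γ.b_u.symm _ _)
  · exact zComm_commute_of_v_u hP γ (pw_commute hP γ.v_z _ _) (pw_commute hP γ.u_z _ _)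
  · exact zComm_commute_of_b_x hP γ (pw_commute hP γ.b_u _ _) (pw_commute hP γ.x_u _ _)
  · exact zComm_commute_of_b_x hP γ (pw_commute hP γ.b_v _ _) (pw_commute hP γ.x_v _ _)

theorem Frame.isGen_x : γ.IsGen γ.x := by simp [Frame.IsGen]
theorem Frame.isGen_a : γ.IsGen γ.a := by simp [Frame.IsGen]
theorem Frame.isGen_b : γ.IsGen γ.b := by simp [Frame.IsGen]
theorem Frame.isGen_z : γ.IsGen γ.z := by simp [Frame.IsGen]
theorem Frame.isGen_u : γ.IsGen γ.u := by simp [Frame.IsGen]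
theorem Frame.isGen_v : γ.IsGen γ.v := by simp [Frame.IsGen]

theorem zComm_commute_zComm (e f e' f' : linExp n) :
    Commute (zComm hP γ e f) (zComm hP γ e' f') :=
  (zComm_commute_of_v_u hP γ (zComm_commute_pw hP γ e f γ.isGen_v e').symm
    (zComm_commute_pw hP γ e f γ.isGen_u f').symm).symm

theorem zComm_add_left (e e' f : linExp n) :
    zComm hP γ (e + e') f = zComm hP γ e f * zComm hP γ e' f := by
  apply mul_left_cancel (a := pw hP γ.u f * pw hP γ.v (e + e'))
  rw [← pw_v_mul_pw_u, pw_add, mul_assoc, pw_v_mul_pw_u, ← mul_assoc, ← mul_assoc, pw_v_mul_pw_u,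
    mul_assoc _ (zComm hP γ e f), (zComm_commute_pw hP γ e f γ.isGen_v e').eq]
  group

theorem zComm_neg_left (e f : linExp n) : zComm hP γ (-e) f = (zComm hP γ e f)⁻¹ := by
  rw [eq_inv_iff_mul_eq_one, ← zComm_add_left, neg_add_cancel]
  simp [zComm, pw_zero]

theorem zComm_add_right (e f f' : linExp n) :
    zComm hP γ e (f + f') = zComm hP γ e f * zComm hP γ e f' := by
  apply mul_left_cancel (a := pw hP γ.u (f + f') * pw hP γ.v e)
  rw [← pw_v_mul_pw_u, pw_add, ← mul_assoc, pw_v_mul_pw_u, mul_assoc,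
    (zComm_commute_pw hP γ e f γ.isGen_u f').eq, ← mul_assoc, mul_assoc _ (pw hP γ.v e),
    pw_v_mul_pw_u, (zComm_commute_zComm hP γ e f e f').eq]
  group

theorem zComm_neg_right (e f : linExp n) : zComm hP γ e (-f) = (zComm hP γ e f)⁻¹ := by
  rw [eq_inv_iff_mul_eq_one, ← zComm_add_right, neg_add_cancel]
  simp [zComm, pw_zero]

theorem pw_v_mul_u (e : linExp n) : pw hP γ.v e * pw hP γ.u (constExp n 1) =
    pw hP γ.u (constExp n 1) * pw hP γ.v e * pw hP γ.z e := by
  rw [pw_conj, mul_assoc γ.u⁻¹, γ.v_u, mul_assoc, inv_mul_cancel_left, pw_mul hP γ.v_z, mul_assoc]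

theorem zComm_one_left (f : linExp n) : zComm hP γ (constExp n 1) f = pw hP γ.z f := by
  have h1 : γ.v⁻¹ * γ.u * γ.v = γ.u * γ.z⁻¹ := by
    have h2 : γ.u * γ.v = γ.v * γ.u * γ.z⁻¹ := by rw [γ.v_u]; group
    rw [mul_assoc, h2]; group
  have h3 := pw_conj hP γ.u γ.v f
  rw [h1, pw_mul hP γ.u_z.inv_right, pw_inv] at h3
  apply mul_left_cancel (a := pw hP γ.u f * pw hP γ.v (constExp n 1))
  rw [← pw_v_mul_pw_u, h3]
  group

/-- The defect of multiplicativity for `(x b⁻¹) ^ e`; it stands for `z ^ (-e (e - 1) / 2)`. -/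
noncomputable def zDefect (e : linExp n) : Asy R n := powDefect hP γ.x γ.b⁻¹ e

theorem Frame.commute_xu_bv : Commute (γ.x * γ.u) (γ.b⁻¹ * γ.v) := by
  have h := γ.commute_bv_xu.inv_left
  rw [mul_inv_rev, inv_inv, ← γ.b_v.inv_left.eq] at h
  exact h.symm

theorem zDefect_eq (e : linExp n) : zDefect hP γ e = (powDefect hP γ.u γ.v e)⁻¹ := by
  rw [eq_inv_iff_mul_eq_one]
  exact powDefect_mul_powDefect hP γ.x_u γ.x_v γ.b_u.inv_left γ.b_v.inv_left γ.commute_xu_bv e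

/-- The defect is central, because it is expressed through `x, b` and also through `u, v`. -/
theorem zDefect_commute_pw (e : linExp n) {g : G} (hg : γ.IsGen g) (t : linExp n) :
    Commute (zDefect hP γ e) (pw hP g t) := by
  have h1 : Commute γ.u g → Commute γ.v g → Commute (zDefect hP γ e) (pw hP g t) := fun hu hv => by
    rw [zDefect_eq]
    exact (((pw_commute hP hu e t).mul_left (pw_commute hP hv e t)).inv_left.mul_left
      (pw_commute hP (hu.mul_left hv) e t)).inv_left
  have h2 : Commute γ.x g → Commute γ.b g → Commute (zDefect hP γ e) (pw hP g t) := fun hx hb =>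
    ((pw_commute hP hx e t).mul_left (pw_commute hP hb.inv_left e t)).inv_left.mul_left
      (pw_commute hP (hx.mul_left hb.inv_left) e t)
  rcases hg with rfl | rfl | rfl | rfl | rfl | rfl
  · exact h1 γ.x_u.symm γ.x_v.symm
  · exact h1 γ.a_u.symm γ.a_v.symm
  · exact h1 γ.b_u.symm γ.b_v.symm
  · exact h1 γ.u_z γ.v_z
  · exact h2 γ.x_u γ.b_u
  · exact h2 γ.x_v γ.b_v

theorem pw_x_mul_b_inv (e : linExp n) :
    pw hP (γ.x * γ.b⁻¹) e = pw hP γ.x e * (pw hP γ.b e)⁻¹ * zDefect hP γ e := by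
  unfold zDefect powDefect
  rw [pw_inv]; group

theorem Frame.commute_xu_bx : Commute (γ.x * γ.u⁻¹) (γ.b⁻¹ * γ.u * (γ.x * γ.v⁻¹)) := by
  have h := (commute_mul_of_twisted (V := γ.v⁻¹) γ.b_u.inv_right γ.x_v.inv_right γ.u_z.inv_left
    γ.b_x (inv_mul_inv_of_twisted γ.u_z γ.v_z γ.v_u)).inv_left.symm
  have h' : Commute (γ.x * γ.u⁻¹) (γ.x * γ.u) :=
    ((Commute.refl _).mul_right γ.x_u).mul_left (γ.x_u.symm.mul_right (Commute.refl _)).inv_left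
  have hz : Commute (γ.x * γ.u⁻¹) γ.z := γ.x_z.mul_left γ.u_z.inv_left
  have e : γ.b⁻¹ * γ.u * (γ.x * γ.v⁻¹) = (γ.b * γ.v⁻¹⁻¹)⁻¹ * (γ.x * γ.u) * γ.z := by
    calc _ = γ.b⁻¹ * (γ.u * γ.x) * γ.v⁻¹ := by group
      _ = γ.b⁻¹ * γ.x * (γ.u * γ.v⁻¹) := by rw [← γ.x_u.eq]; group
      _ = γ.b⁻¹ * (γ.x * γ.v⁻¹) * γ.u * γ.z := by
        rw [mul_inv_comm_of_twisted γ.v_z γ.v_u]; group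
      _ = _ := by rw [γ.x_v.inv_right.eq, inv_inv, γ.b_v.eq]; group
  rw [e]
  exact (h.mul_right h').mul_right hz

/-- Exchanging the two factors inverts the defect. The defects of `x, b⁻¹ u` and `u⁻¹, x v⁻¹`
cancel, and the defect does not change when a factor that commutes with both entries is moved in or
out of an entry. -/
theorem powDefect_inv_b_x (e : linExp n) :
    powDefect hP γ.b⁻¹ γ.x e = (zDefect hP γ e)⁻¹ := by
  have hb : Commute (γ.b⁻¹ * γ.u) (γ.x * γ.v⁻¹) := by
    have h := (commute_mul_of_twisted γ.b_v.inv_right γ.x_u γ.v_z.inv_left γ.b_x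
      (mul_inv_comm_of_twisted γ.v_z γ.v_u)).inv_left
    rwa [mul_inv_rev, inv_inv, ← γ.b_u.inv_left.eq] at h
  have h1 : powDefect hP γ.x (γ.b⁻¹ * γ.u) e * powDefect hP γ.u⁻¹ (γ.x * γ.v⁻¹) e = 1 := by
    refine powDefect_mul_powDefect hP γ.x_u.inv_right
      ((Commute.refl _).mul_right γ.x_v.inv_right) ?_ hb ?_ e
    · exact (γ.b_u.inv_left.mul_left (Commute.refl _)).inv_right
    · exact γ.commute_xu_bx
  have h2 : powDefect hP γ.x (γ.b⁻¹ * γ.u) e = zDefect hP γ e :=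
    powDefect_mul_right hP γ.x_u γ.b_u.inv_left e
  have h3 : powDefect hP (γ.u⁻¹ * (γ.b⁻¹ * γ.u)) (γ.x * γ.v⁻¹) e =
      powDefect hP γ.u⁻¹ (γ.x * γ.v⁻¹) e :=
    powDefect_mul_left hP (γ.b_u.inv_left.mul_left (Commute.refl _)).symm.inv_left hb.symm e
  have h4 : γ.u⁻¹ * (γ.b⁻¹ * γ.u) = γ.b⁻¹ := by rw [γ.b_u.inv_left.eq]; group
  have h5 : powDefect hP γ.b⁻¹ (γ.x * γ.v⁻¹) e = powDefect hP γ.b⁻¹ γ.x e :=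
    powDefect_mul_right hP γ.b_v.inv_left.inv_right γ.x_v.inv_right e
  rw [h2, ← h3, h4, h5] at h1
  exact (inv_eq_of_mul_eq_one_right h1).symm

/-- The square of the defect is `z ^ e` times the inverse of the commutator that stands for
`z ^ (e ²)`: compare the powers of `b⁻¹ x = x b⁻¹ z⁻¹`. -/
theorem zDefect_mul_self (e : linExp n) :
    zDefect hP γ e * zDefect hP γ e * zComm hP γ e e = pw hP γ.z e := by
  have h1 : γ.b⁻¹ * γ.x = γ.x * γ.b⁻¹ * γ.z⁻¹ := by
    rw [inv_mul_eq_iff_eq_mul, ← mul_assoc, ← mul_assoc, γ.b_x, mul_assoc _ γ.z,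
      ← γ.b_z.inv_left.eq]
    group
  have h2 := pw_mul hP (γ.x_z.mul_left γ.b_z.inv_left).inv_right e
  rw [← h1, pw_inv, pw_x_mul_b_inv] at h2
  have h3 : pw hP (γ.b⁻¹ * γ.x) e =
      (pw hP γ.b e)⁻¹ * pw hP γ.x e * (zDefect hP γ e)⁻¹ := by
    rw [← powDefect_inv_b_x, powDefect, pw_inv]; group
  have h4 : (pw hP γ.b e)⁻¹ * pw hP γ.x e =
      pw hP γ.x e * (pw hP γ.b e)⁻¹ * (zComm hP γ e e)⁻¹ := by
    rw [inv_mul_eq_iff_eq_mul, ← mul_assoc, ← mul_assoc, pw_b_mul_pw_x, mul_assoc _ (zComm _ _ _ _),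
      (zComm_commute_pw hP γ e e γ.isGen_b e).inv_right.eq]
    group
  rw [h3, h4, mul_assoc, mul_assoc _ _ (pw hP γ.z e)⁻¹] at h2
  have h5 := mul_left_cancel h2
  have h6 : Commute (zDefect hP γ e) (zComm hP γ e e) :=
    (zComm_commute_of_v_u hP γ (zDefect_commute_pw hP γ e γ.isGen_v e).symm
      (zDefect_commute_pw hP γ e γ.isGen_u e).symm).symm
  calc _ = zDefect hP γ e * (zDefect hP γ e * (pw hP γ.z e)⁻¹) * pw hP γ.z e * zComm hP γ e e := by
        group
    _ = (zDefect hP γ e * (zComm hP γ e e)⁻¹) * (zDefect hP γ e)⁻¹ *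
          (pw hP γ.z e * zComm hP γ e e) := by rw [← h5]; group
    _ = _ := by
        rw [h6.inv_right.eq, (zComm_commute_pw hP γ e e γ.isGen_z e).symm.eq]; group

end Algebra

/-! ### Normal form words and their rewriting rules -/

section NormalForm

variable {k : ℕ} {R : Set (FreeGroup (Fin k))} {ι : Type*} {G : Type*} [Group G] {s : Fin k → G}
  (hP : IsFinitePresentation s R) (n : ι → ℕ+) (γ : Frame G)

/-- `a ^ e` conjugated by `x ^ n`. -/
noncomputable def aUp (e : linExp n) : Asy R n :=
  (pw hP γ.x (scaleExp n))⁻¹ * pw hP γ.a e * pw hP γ.x (scaleExp n)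

/-- `a ^ e` conjugated by `x ^ (-n)`. -/
noncomputable def aDown (e : linExp n) : Asy R n :=
  pw hP γ.x (scaleExp n) * pw hP γ.a e * (pw hP γ.x (scaleExp n))⁻¹

theorem aUp_add (e f : linExp n) : aUp hP n γ (e + f) = aUp hP n γ e * aUp hP n γ f := by
  unfold aUp; rw [pw_add]; group

theorem aDown_add (e f : linExp n) : aDown hP n γ (e + f) = aDown hP n γ e * aDown hP n γ f := by
  unfold aDown; rw [pw_add]; group

theorem aDown_neg (e : linExp n) : aDown hP n γ (-e) = (aDown hP n γ e)⁻¹ := by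
  unfold aDown; rw [pw_neg]; group

variable {n}

theorem pw_a_mul_x (e : linExp n) : pw hP γ.a e * pw hP γ.x (constExp n 1) =
    pw hP γ.x (constExp n 1) * (pw hP γ.a e * pw hP γ.b e) := by
  rw [pw_conj, mul_assoc γ.x⁻¹, γ.a_x, mul_assoc, inv_mul_cancel_left, pw_mul hP γ.a_b]

theorem pw_b_mul_x (e : linExp n) : pw hP γ.b e * pw hP γ.x (constExp n 1) =
    pw hP γ.x (constExp n 1) * (pw hP γ.b e * pw hP γ.z e) := by
  rw [pw_conj, mul_assoc γ.x⁻¹, γ.b_x, mul_assoc, inv_mul_cancel_left, pw_mul hP γ.b_z]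

theorem pw_x_mul_a (e : linExp n) : pw hP γ.x e * pw hP γ.a (constExp n 1) =
    pw hP γ.a (constExp n 1) * (pw hP γ.x e * (pw hP γ.b e)⁻¹ * zDefect hP γ e) := by
  have h : γ.a⁻¹ * γ.x * γ.a = γ.x * γ.b⁻¹ := by
    have h1 : γ.x * γ.a = γ.a * γ.x * γ.b⁻¹ := by
      rw [γ.a_x]; group
    rw [mul_assoc, h1]; group
  rw [pw_conj, h, pw_x_mul_b_inv]

theorem conj_pw_b (e f : linExp n) :
    (pw hP γ.x f)⁻¹ * pw hP γ.b e * pw hP γ.x f = pw hP γ.b e * zComm hP γ e f := by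
  rw [mul_assoc, pw_b_mul_pw_x]; group

theorem conj_inv_pw_b (e f : linExp n) :
    pw hP γ.x f * pw hP γ.b e * (pw hP γ.x f)⁻¹ = pw hP γ.b e * (zComm hP γ e f)⁻¹ := by
  have := conj_pw_b hP γ e (-f)
  rwa [pw_neg, inv_inv, zComm_neg_right] at this

theorem zDefect_commute_zComm (e f g : linExp n) :
    Commute (zDefect hP γ e) (zComm hP γ f g) :=
  (zComm_commute_of_v_u hP γ (zDefect_commute_pw hP γ e γ.isGen_v f).symm
    (zDefect_commute_pw hP γ e γ.isGen_u g).symm).symm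

/-- `x ^ (-n) a x ^ n = a b ^ n` up to a central factor. -/
theorem aUp_one : aUp hP n γ (constExp n 1) = pw hP γ.a (constExp n 1) *
    (pw hP γ.b (scaleExp n) * (zDefect hP γ (scaleExp n))⁻¹) := by
  unfold aUp
  rw [mul_assoc, inv_mul_eq_iff_eq_mul, ← mul_assoc, pw_x_mul_a,
    (zDefect_commute_pw hP γ _ γ.isGen_b _).inv_left.symm.eq]
  group

/-- `x ^ n a x ^ (-n) = a b ^ (-n)` up to a central factor. -/
theorem aDown_one : aDown hP n γ (constExp n 1) = pw hP γ.a (constExp n 1) *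
    ((pw hP γ.b (scaleExp n))⁻¹ *
      (zComm hP γ (scaleExp n) (scaleExp n) * zDefect hP γ (scaleExp n))) := by
  have h := conj_inv_pw_b hP γ (-scaleExp n) (scaleExp n)
  rw [zComm_neg_left, inv_inv, pw_neg, mul_assoc, ← eq_inv_mul_iff_mul_eq] at h
  unfold aDown
  rw [pw_x_mul_a, mul_assoc, mul_assoc, mul_assoc,
    (zDefect_commute_pw hP γ _ γ.isGen_x _).inv_right.eq, ← mul_assoc _ _ (zDefect _ _ _), h]
  group

/-- `t` commutes with every family of powers of `a` and of its conjugates by `x ^ n` and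
`x ^ (-n)`. -/
def CommutesA (t : Asy R n) : Prop :=
  ∀ e, Commute t (pw hP γ.a e) ∧ Commute t (aUp hP n γ e) ∧ Commute t (aDown hP n γ e)

variable {hP γ}

theorem CommutesA.mul {t t' : Asy R n} (h : CommutesA hP γ t) (h' : CommutesA hP γ t') :
    CommutesA hP γ (t * t') := fun e =>
  ⟨(h e).1.mul_left (h' e).1, (h e).2.1.mul_left (h' e).2.1, (h e).2.2.mul_left (h' e).2.2⟩

theorem CommutesA.inv {t : Asy R n} (h : CommutesA hP γ t) : CommutesA hP γ t⁻¹ := fun e =>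
  ⟨(h e).1.inv_left, (h e).2.1.inv_left, (h e).2.2.inv_left⟩

theorem commutesA_of_conj {t : Asy R n} (h : ∀ e, Commute t (pw hP γ.a e))
    (h1 : ∀ e, Commute (pw hP γ.x (scaleExp n) * t * (pw hP γ.x (scaleExp n))⁻¹) (pw hP γ.a e))
    (h2 : ∀ e, Commute ((pw hP γ.x (scaleExp n))⁻¹ * t * pw hP γ.x (scaleExp n)) (pw hP γ.a e)) :
    CommutesA hP γ t := by
  intro e
  refine ⟨h e, ?_, ?_⟩
  · have := congrArg (fun y => (pw hP γ.x (scaleExp n))⁻¹ * y * pw hP γ.x (scaleExp n)) (h1 e).eq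
    unfold aUp
    change _ = _
    group at this ⊢
    exact this
  · have := congrArg (fun y => pw hP γ.x (scaleExp n) * y * (pw hP γ.x (scaleExp n))⁻¹) (h2 e).eq
    unfold aDown
    change _ = _
    group at this ⊢
    exact this

theorem commutesA_of_x {t : Asy R n} (h : ∀ e, Commute t (pw hP γ.a e))
    (h1 : Commute t (pw hP γ.x (scaleExp n))) : CommutesA hP γ t := by
  refine commutesA_of_conj h (fun e => ?_) (fun e => ?_)
  · rw [← h1.eq, mul_inv_cancel_right]; exact h e
  · rw [mul_assoc, h1.eq, inv_mul_cancel_left]; exact h e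

variable (hP γ)

theorem commutesA_zComm (e f : linExp n) : CommutesA hP γ (zComm hP γ e f) :=
  commutesA_of_x (fun t => zComm_commute_pw hP γ e f γ.isGen_a t)
    (zComm_commute_pw hP γ e f γ.isGen_x _)

theorem commutesA_zDefect (e : linExp n) : CommutesA hP γ (zDefect hP γ e) :=
  commutesA_of_x (fun t => zDefect_commute_pw hP γ e γ.isGen_a t)
    (zDefect_commute_pw hP γ e γ.isGen_x _)

theorem commutesA_b (e : linExp n) : CommutesA hP γ (pw hP γ.b e) := by
  have h : ∀ t, Commute (pw hP γ.b e) (pw hP γ.a t) := fun t => pw_commute hP γ.a_b.symm e t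
  refine commutesA_of_conj h (fun t => ?_) (fun t => ?_)
  · rw [conj_inv_pw_b]
    exact (h t).mul_left (commutesA_zComm hP γ _ _ t).1.inv_left
  · rw [conj_pw_b]
    exact (h t).mul_left (commutesA_zComm hP γ _ _ t).1

/-- Although `a ^ e` need not commute with the conjugate of `a ^ f` by `x ^ n` at quadratic cost,
a single letter `a` does. -/
theorem commutesA_a : CommutesA hP γ (pw hP γ.a (constExp n 1)) := by
  have h : ∀ t, Commute (pw hP γ.a (constExp n 1)) (pw hP γ.a t) :=
    fun t => pw_commute hP (Commute.refl _) _ t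
  refine commutesA_of_conj h (fun t => ?_) (fun t => ?_)
  · change Commute (aDown hP n γ (constExp n 1)) _
    rw [aDown_one]
    exact (h t).mul_left ((commutesA_b hP γ _ t).1.inv_left.mul_left
      ((commutesA_zComm hP γ _ _ t).1.mul_left (commutesA_zDefect hP γ _ t).1))
  · change Commute (aUp hP n γ (constExp n 1)) _
    rw [aUp_one]
    exact (h t).mul_left ((commutesA_b hP γ _ t).1.mul_left
      (commutesA_zDefect hP γ _ t).1.inv_left)

theorem commutesA_aUp : CommutesA hP γ (aUp hP n γ (constExp n 1)) := by
  rw [aUp_one]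
  exact (commutesA_a hP γ).mul ((commutesA_b hP γ _).mul (commutesA_zDefect hP γ _).inv)

/-- The second difference of the conjugates of `a` by powers of `x ^ n` is `z ^ (n ^ 2)`. -/
theorem zComm_scale_eq : zComm hP γ (scaleExp n) (scaleExp n) =
    (pw hP γ.a (constExp n 1))⁻¹ * (pw hP γ.a (constExp n 1))⁻¹ *
      (aUp hP n γ (constExp n 1) * aDown hP n γ (constExp n 1)) := by
  have h : Commute (pw hP γ.b (scaleExp n) * (zDefect hP γ (scaleExp n))⁻¹)
      (pw hP γ.a (constExp n 1)) :=
    (commutesA_b hP γ _ _).1.mul_left (commutesA_zDefect hP γ _ _).1.inv_left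
  rw [aUp_one, aDown_one, mul_assoc (pw hP γ.a (constExp n 1)) (_ * _),
    ← mul_assoc (pw hP γ.b (scaleExp n) * _) (pw hP γ.a (constExp n 1)), h.eq,
    (zDefect_commute_pw hP γ _ γ.isGen_b _).inv_left.symm.eq,
    ((zDefect_commute_zComm hP γ _ _ _).symm).eq]
  group

/-- The first difference of the conjugates of `a` by `x ^ n` and `x ^ (-n)` is
`b ^ (2 n) z ^ (-n)`. -/
theorem pw_b_two_scale : pw hP γ.b (scaleExp n + scaleExp n) =
    aUp hP n γ (constExp n 1) * (aDown hP n γ (constExp n 1))⁻¹ * pw hP γ.z (scaleExp n) := by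
  have h : Commute (pw hP γ.b (scaleExp n)) (pw hP γ.a (constExp n 1)) := (commutesA_b hP γ _ _).1
  have h1 : Commute (zDefect hP γ (scaleExp n)) (pw hP γ.a (constExp n 1)) :=
    (commutesA_zDefect hP γ _ _).1
  have h2 := zDefect_commute_pw hP γ (scaleExp n) γ.isGen_b (scaleExp n)
  have h3 := zComm_commute_pw hP γ (scaleExp n) (scaleExp n) γ.isGen_b (scaleExp n)
  have h4 := zDefect_commute_zComm hP γ (scaleExp n) (scaleExp n) (scaleExp n)
  have hKA : Commute (zComm hP γ (scaleExp n) (scaleExp n)) (pw hP γ.a (constExp n 1)) :=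
    (commutesA_zComm hP γ _ _ _).1
  rw [aUp_one, aDown_one, ← zDefect_mul_self, pw_add]
  generalize pw hP γ.b (scaleExp n) = B at *
  generalize pw hP γ.a (constExp n 1) = A at *
  generalize zDefect hP γ (scaleExp n) = Z at *
  generalize zComm hP γ (scaleExp n) (scaleExp n) = K at *
  have hB : Commute (Z * Z * K) B := (h2.mul_left h2).mul_left h3
  have hA : Commute (Z * Z * K) A := (h1.mul_left h1).mul_left hKA
  have hK : Z * Z * K = K * Z * Z := by rw [(h4.mul_left h4).eq]; group
  calc B * B = A * (B * B) * A⁻¹ := by rw [← (h.mul_left h).eq]; group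
    _ = A * (B * (Z * Z * K)⁻¹ * (B * (Z * Z * K))) * A⁻¹ := by rw [← hB.eq]; group
    _ = A * (B * (Z * Z * K)⁻¹ * B) * ((Z * Z * K) * A⁻¹) := by group
    _ = A * (B * (K * Z * Z)⁻¹ * B) * (A⁻¹ * (Z * Z * K)) := by rw [hA.inv_right.eq, hK]
    _ = _ := by group

variable (n)

/-- The normal form word
`x ^ i a ^ (s - 2 c) (a ^ (c + d)) ^ (x ^ n) (a ^ (c - d)) ^ (x ^ (-n)) b ^ k [v ^ q, u ^ n] z ^ l
u ^ m v ^ r` as an element of the asymptotic group. -/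
noncomputable def nf (i s c d k q l m r : linExp n) : Asy R n :=
  pw hP γ.x i * pw hP γ.a (s - c - c) * aUp hP n γ (c + d) * aDown hP n γ (c - d) * pw hP γ.b k *
    zComm hP γ q (scaleExp n) * pw hP γ.z l * pw hP γ.u m * pw hP γ.v r

variable {n}

theorem nf_mul_v (i s c d k q l m r : linExp n) :
    nf hP n γ i s c d k q l m r * pw hP γ.v (constExp n 1) =
      nf hP n γ i s c d k q l m (r + constExp n 1) := by
  unfold nf
  rw [pw_add, ← mul_assoc]

theorem nf_mul_u (i s c d k q l m r : linExp n) :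
    nf hP n γ i s c d k q l m r * pw hP γ.u (constExp n 1) =
      nf hP n γ i s c d k q (l + r) (m + constExp n 1) r := by
  unfold nf
  have h := (pw_commute hP γ.v_z r r).eq
  have h' := pw_commute hP γ.u_z (constExp n 1) r
  have h'' := pw_commute hP γ.u_z m r
  rw [mul_assoc _ (pw hP γ.v r), pw_v_mul_u, mul_assoc _ (pw hP γ.v r), h, pw_add hP γ.z, pw_add]
  simp only [mul_assoc, h'.left_comm, h''.left_comm]

theorem nf_mul_z (i s c d k q l m r : linExp n) :
    nf hP n γ i s c d k q l m r * pw hP γ.z (constExp n 1) =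
      nf hP n γ i s c d k q (l + constExp n 1) m r := by
  unfold nf
  rw [mul_assoc, (pw_commute hP γ.v_z r _).eq, ← mul_assoc, mul_assoc _ (pw hP γ.u m),
    (pw_commute hP γ.u_z m _).eq, pw_add]
  simp only [mul_assoc]

/-- Elements commuting with `[v ^ q, u ^ n]`, `z`, `u` and `v` can be inserted after `b ^ k`. -/
theorem nf_tail_mul {q l m r : linExp n} {t : Asy R n} (h1 : Commute (zComm hP γ q (scaleExp n)) t)
    (h2 : Commute (pw hP γ.z l) t) (h3 : Commute (pw hP γ.u m) t) (h4 : Commute (pw hP γ.v r) t)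
    (y : Asy R n) :
    y * zComm hP γ q (scaleExp n) * pw hP γ.z l * pw hP γ.u m * pw hP γ.v r * t =
      y * t * zComm hP γ q (scaleExp n) * pw hP γ.z l * pw hP γ.u m * pw hP γ.v r := by
  rw [mul_assoc _ _ t, h4.eq, ← mul_assoc, mul_assoc _ _ t, h3.eq, ← mul_assoc, mul_assoc _ _ t,
    h2.eq, ← mul_assoc, mul_assoc y _ t, h1.eq, ← mul_assoc]

theorem nf_mul_b (i s c d k q l m r : linExp n) :
    nf hP n γ i s c d k q l m r * pw hP γ.b (constExp n 1) =
      nf hP n γ i s c d (k + constExp n 1) q l m r := by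
  unfold nf
  rw [nf_tail_mul hP γ (zComm_commute_pw hP γ _ _ γ.isGen_b _) (pw_commute hP γ.b_z.symm _ _)
    (pw_commute hP γ.b_u.symm _ _) (pw_commute hP γ.b_v.symm _ _), pw_add hP γ.b, ← mul_assoc]

theorem nf_mul_a (i s c d k q l m r : linExp n) :
    nf hP n γ i s c d k q l m r * pw hP γ.a (constExp n 1) =
      nf hP n γ i (s + constExp n 1) c d k q l m r := by
  unfold nf
  rw [nf_tail_mul hP γ (zComm_commute_pw hP γ _ _ γ.isGen_a _) (pw_commute hP γ.a_z.symm _ _)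
    (pw_commute hP γ.a_u.symm _ _) (pw_commute hP γ.a_v.symm _ _), mul_assoc _ (pw hP γ.b k),
    (pw_commute hP γ.a_b.symm _ _).eq, ← mul_assoc, mul_assoc _ (aDown _ _ _ _),
    ← (commutesA_a hP γ _).2.2.eq, ← mul_assoc, mul_assoc _ (aUp _ _ _ _),
    ← (commutesA_a hP γ _).2.1.eq, ← mul_assoc, mul_assoc _ (pw hP γ.a _) (pw hP γ.a _), ← pw_add,
    show s - c - c + constExp n 1 = s + constExp n 1 - c - c by abel]

theorem nf_carry_z (i s c d k q l m r : linExp n) :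
    nf hP n γ i s c d k q l m r =
      nf hP n γ i s c d k (q + constExp n 1) (l - scaleExp n) m r := by
  unfold nf
  rw [zComm_add_left, zComm_one_left, mul_assoc _ (_ * _) (pw hP γ.z _),
    mul_assoc (zComm _ _ _ _), ← pw_add, add_sub_cancel, ← mul_assoc]

theorem aUp_mul_x (e : linExp n) : aUp hP n γ e * pw hP γ.x (constExp n 1) =
    pw hP γ.x (constExp n 1) *
      (aUp hP n γ e * (pw hP γ.b e * zComm hP γ e (scaleExp n))) := by
  have h : Commute (pw hP γ.x (scaleExp n)) (pw hP γ.x (constExp n 1)) :=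
    pw_commute hP (Commute.refl _) _ _
  rw [← conj_pw_b]
  unfold aUp
  rw [mul_assoc, h.eq, ← mul_assoc, mul_assoc _ (pw hP γ.a e), pw_a_mul_x, ← mul_assoc,
    h.inv_left.eq]
  group

theorem aDown_mul_x (e : linExp n) : aDown hP n γ e * pw hP γ.x (constExp n 1) =
    pw hP γ.x (constExp n 1) *
      (aDown hP n γ e * (pw hP γ.b e * (zComm hP γ e (scaleExp n))⁻¹)) := by
  have h : Commute (pw hP γ.x (scaleExp n)) (pw hP γ.x (constExp n 1)) :=
    pw_commute hP (Commute.refl _) _ _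
  rw [← conj_inv_pw_b]
  unfold aDown
  rw [mul_assoc, h.inv_left.eq, ← mul_assoc, mul_assoc _ (pw hP γ.a e), pw_a_mul_x, ← mul_assoc,
    h.eq]
  group

theorem nf_mul_x (i s c d k q l m r : linExp n) :
    nf hP n γ i s c d k q l m r * pw hP γ.x (constExp n 1) =
      nf hP n γ (i + constExp n 1) s c d (k + s) (q + d + d) (l + k) m r := by
  -- Moving `x` to the left multiplies each power of a conjugate of `a` by the same power of `b`,
  -- and the two kinds of conjugates contribute opposite commutators with `u ^ n`.
  have e1 : k + s = (s - c - c) + (c + d) + (c - d) + k := by abel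
  have e2 : q + d + d = (c + d) + -(c - d) + q := by abel
  unfold nf
  rw [nf_tail_mul hP γ (zComm_commute_pw hP γ _ _ γ.isGen_x _) (pw_commute hP γ.x_z.symm _ _)
    (pw_commute hP γ.x_u.symm _ _) (pw_commute hP γ.x_v.symm _ _), mul_assoc _ (pw hP γ.b k),
    pw_b_mul_x, ← mul_assoc _ (pw hP γ.x _), mul_assoc _ (aDown _ _ _ _), aDown_mul_x,
    ← mul_assoc _ (pw hP γ.x _), mul_assoc _ (aUp _ _ _ _) (pw hP γ.x _), aUp_mul_x,
    ← mul_assoc _ (pw hP γ.x _), mul_assoc _ (pw hP γ.a _) (pw hP γ.x _), pw_a_mul_x,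
    ← mul_assoc _ (pw hP γ.x _), ← pw_add, e1, e2, pw_add hP γ.z,
    zComm_add_left hP γ (c + d + -(c - d)),
    zComm_add_left hP γ (c + d) (-(c - d)),
    zComm_neg_left, pw_add hP γ.b (_ + _ + _) k, pw_add hP γ.b (_ + _) (c - d),
    pw_add hP γ.b _ (c + d)]
  have hbU := (commutesA_b hP γ (s - c - c) (c + d)).2.1
  have hbD := fun e => (commutesA_b hP γ e (c - d)).2.2
  have hKD := (commutesA_zComm hP γ (c + d) (scaleExp n) (c - d)).2.2
  have hKb := fun e g => zComm_commute_pw hP γ e (scaleExp n) γ.isGen_b g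
  have hKz := zComm_commute_pw hP γ q (scaleExp n) γ.isGen_z k
  have hz : Commute (pw hP γ.z k) (pw hP γ.z l) := pw_commute hP (Commute.refl _) _ _
  simp only [mul_assoc, hbU.left_comm, (hbD _).left_comm, hKD.left_comm, (hKb _ _).left_comm,
    (hKb _ _).inv_left.left_comm, hKz.symm.left_comm, hz.left_comm]

theorem nf_carry_n2 (i s c d k q l m r : linExp n) :
    nf hP n γ i s c d k q l m r =
      nf hP n γ i s (c + constExp n 1) d k (q - scaleExp n) l m r := by
  have hA : pw hP γ.a (s - c - c) = pw hP γ.a (s - (c + constExp n 1) - (c + constExp n 1)) *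
      pw hP γ.a (constExp n 1) * pw hP γ.a (constExp n 1) := by
    rw [← pw_add, ← pw_add]; congr 1; abel
  have h1 : c + constExp n 1 + d = c + d + constExp n 1 := by abel
  have h2 : c + constExp n 1 - d = c - d + constExp n 1 := by abel
  have h3 : q = scaleExp n + (q - scaleExp n) := by abel
  have haU := (commutesA_a hP γ (c + d)).2.1.inv_left
  have haD := (commutesA_a hP γ (c - d)).2.2.inv_left
  have hUD := (commutesA_aUp hP γ (c - d)).2.2
  have hb : Commute (zComm hP γ (scaleExp n) (scaleExp n)) (pw hP γ.b k) :=
    zComm_commute_pw hP γ _ _ γ.isGen_b _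
  unfold nf
  rw [h1, h2, aUp_add hP n γ (c + d), aDown_add]
  conv_lhs => rw [h3, zComm_add_left, hA, ← mul_assoc _ (zComm hP γ (scaleExp n) (scaleExp n)),
    mul_assoc _ (pw hP γ.b k), ← hb.eq, zComm_scale_eq]
  simp only [mul_assoc, haU.symm.left_comm, haD.symm.left_comm, mul_inv_cancel_left,
    hUD.left_comm]

theorem nf_carry_b (i s c d k q l m r : linExp n) :
    nf hP n γ i s c d k q l m r =
      nf hP n γ i s c (d + constExp n 1) (k - (scaleExp n + scaleExp n)) q (l + scaleExp n) m r := by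
  have h1 : c + (d + constExp n 1) = c + d + constExp n 1 := by abel
  have h2 : c - (d + constExp n 1) = c - d + -constExp n 1 := by abel
  have h3 : k = scaleExp n + scaleExp n + (k - (scaleExp n + scaleExp n)) := by abel
  have hUD := (commutesA_aUp hP γ (c - d)).2.2
  have hzb : Commute (pw hP γ.z (scaleExp n))
    (pw hP γ.b (k - (scaleExp n + scaleExp n))) := pw_commute hP γ.b_z.symm _ _
  have hzK : Commute (pw hP γ.z (scaleExp n)) (zComm hP γ q (scaleExp n)) :=
    (zComm_commute_pw hP γ _ _ γ.isGen_z _).symm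
  unfold nf
  rw [h1, h2, aUp_add hP n γ (c + d), aDown_add, aDown_neg]
  conv_lhs => rw [h3, pw_add, pw_b_two_scale]
  rw [add_comm l, pw_add hP γ.z]
  simp only [mul_assoc, hUD.left_comm, hzb.left_comm, hzK.left_comm]

end NormalForm

/-! ### A polynomial model group -/

/-- The integer points of the model: `(i, s, t, w, m, r)` stands for `x ^ i u ^ m` times the vector
with coordinates `s, t, w / 2, r` along `a, b, z, v`, up to a change of basis that makes the action
of `x` the exponential of a nilpotent matrix. -/
@[ext] structure Model where
  /-- exponent of `x` -/
  i : ℤ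
  /-- exponent of `a` -/
  s : ℤ
  /-- coordinate along `b` -/
  t : ℤ
  /-- twice the coordinate along `z` -/
  w : ℤ
  /-- exponent of `u` -/
  m : ℤ
  /-- exponent of `v` -/
  r : ℤ

namespace Model

instance : One Model := ⟨⟨0, 0, 0, 0, 0, 0⟩⟩

instance : Mul Model := ⟨fun g h => ⟨g.i + h.i, g.s + h.s, g.t + h.i * g.s + h.t,
  g.w + 2 * h.i * g.t + h.i ^ 2 * g.s + 2 * h.m * g.r + h.w, g.m + h.m, g.r + h.r⟩⟩

instance : Inv Model := ⟨fun g => ⟨-g.i, -g.s, -(g.t - g.i * g.s),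
  -(g.w - 2 * g.i * g.t + g.i ^ 2 * g.s - 2 * g.m * g.r), -g.m, -g.r⟩⟩

theorem mul_def (g h : Model) : g * h = ⟨g.i + h.i, g.s + h.s, g.t + h.i * g.s + h.t,
  g.w + 2 * h.i * g.t + h.i ^ 2 * g.s + 2 * h.m * g.r + h.w, g.m + h.m, g.r + h.r⟩ := rfl

theorem one_def : (1 : Model) = ⟨0, 0, 0, 0, 0, 0⟩ := rfl

theorem inv_def (g : Model) : g⁻¹ = ⟨-g.i, -g.s, -(g.t - g.i * g.s),
  -(g.w - 2 * g.i * g.t + g.i ^ 2 * g.s - 2 * g.m * g.r), -g.m, -g.r⟩ := rfl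

instance : Group Model := Group.ofLeftAxioms
  (fun a b c => by ext <;> simp only [mul_def] <;> ring)
  (fun a => by ext <;> simp only [mul_def, one_def] <;> ring)
  (fun a => by ext <;> simp only [mul_def, one_def, inv_def] <;> ring)

/-- The image of `x` in the model. -/
def x : Model := ⟨1, 0, 0, 0, 0, 0⟩
/-- The image of `a` in the model. -/
def a : Model := ⟨0, 1, 0, 0, 0, 0⟩
/-- The image of `b` in the model; its last coordinate comes from `a x = x a b`. -/
def b : Model := ⟨0, 0, 1, 1, 0, 0⟩
/-- The image of `z` in the model. -/
def z : Model := ⟨0, 0, 0, 2, 0, 0⟩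
/-- The image of `u` in the model. -/
def u : Model := ⟨0, 0, 0, 0, 1, 0⟩
/-- The image of `v` in the model. -/
def v : Model := ⟨0, 0, 0, 0, 0, 1⟩

end Model

/-! ### Normal form parameters -/

/-- The exponents in a normal form word. -/
@[ext] structure NF where
  /-- exponent of `x` -/
  i : ℤ
  /-- total exponent of `a` -/
  s : ℤ
  /-- coefficient of the second difference of the conjugates of `a` -/
  c : ℤ
  /-- coefficient of the first difference of the conjugates of `a` -/
  d : ℤ
  /-- exponent of `b` -/
  k : ℤ
  /-- exponent of `v` in the commutator with `u ^ N` -/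
  q : ℤ
  /-- exponent of `z` -/
  l : ℤ
  /-- exponent of `u` -/
  m : ℤ
  /-- exponent of `v` -/
  r : ℤ

namespace NF

/-- The value in the model group of the normal form word of scale `N`. -/
def eval (N : ℕ) (p : NF) : Model :=
  ⟨p.i, p.s, 2 * N * p.d + p.k, 2 * p.c * N ^ 2 + p.k + 2 * N * p.q + 2 * p.l, p.m, p.r⟩

/-- All exponents are at most `K N` in absolute value. -/
structure Bdd (K N : ℕ) (p : NF) : Prop where
  i : |p.i| ≤ K * N
  s : |p.s| ≤ K * N
  c : |p.c| ≤ K * N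
  d : |p.d| ≤ K * N
  k : |p.k| ≤ K * N
  q : |p.q| ≤ K * N
  l : |p.l| ≤ K * N
  m : |p.m| ≤ K * N
  r : |p.r| ≤ K * N

/-- Exponents after right multiplication by `x`. -/
def mulX (p : NF) : NF :=
  { p with i := p.i + 1, k := p.k + p.s, q := p.q + p.d + p.d, l := p.l + p.k }
/-- Exponents after right multiplication by `x⁻¹`. -/
def mulXInv (p : NF) : NF :=
  { p with i := p.i - 1, k := p.k - p.s, q := p.q - p.d - p.d, l := p.l - (p.k - p.s) }
/-- Exponents after right multiplication by `a ^ e`. -/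
def mulA (e : ℤ) (p : NF) : NF := { p with s := p.s + e }
/-- Exponents after right multiplication by `b ^ e`. -/
def mulB (e : ℤ) (p : NF) : NF := { p with k := p.k + e }
/-- Exponents after right multiplication by `z ^ e`. -/
def mulZ (e : ℤ) (p : NF) : NF := { p with l := p.l + e }
/-- Exponents after right multiplication by `u`. -/
def mulU (p : NF) : NF := { p with l := p.l + p.r, m := p.m + 1 }
/-- Exponents after right multiplication by `u⁻¹`. -/
def mulUInv (p : NF) : NF := { p with l := p.l - p.r, m := p.m - 1 }
/-- Exponents after right multiplication by `v ^ e`. -/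
def mulV (e : ℤ) (p : NF) : NF := { p with r := p.r + e }

/-- Carrying `z ^ (e N) = [v ^ e, u ^ N]`. -/
def carryZ (e : ℤ) (N : ℕ) (p : NF) : NF := { p with q := p.q + e, l := p.l - e * N }
/-- Carrying `[v ^ (e N), u ^ N]` to the second difference. -/
def carryQ (e : ℤ) (N : ℕ) (p : NF) : NF := { p with c := p.c + e, q := p.q - e * N }
/-- Carrying `b ^ (2 e N)` to the first difference. -/
def carryB (e : ℤ) (N : ℕ) (p : NF) : NF :=
  { p with d := p.d + e, k := p.k - e * (N + N), l := p.l + e * N }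

end NF

section Words

variable {k : ℕ} {R : Set (FreeGroup (Fin k))} {G : Type*} [Group G] {s : Fin k → G}
  (hP : IsFinitePresentation s R) (γ : Frame G)

/-- The fixed word that represents a group element. -/
noncomputable def lit (g : G) : FreeGroup (Fin k) := Function.surjInv hP.surjective g

/-- The normal form word of scale `N`. -/
noncomputable def nfWord (N : ℕ) (p : NF) : FreeGroup (Fin k) :=
  lit hP γ.x ^ p.i * lit hP γ.a ^ (p.s - p.c - p.c) *
    ((lit hP γ.x ^ (N : ℤ))⁻¹ * lit hP γ.a ^ (p.c + p.d) * lit hP γ.x ^ (N : ℤ)) *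
    (lit hP γ.x ^ (N : ℤ) * lit hP γ.a ^ (p.c - p.d) * (lit hP γ.x ^ (N : ℤ))⁻¹) *
    lit hP γ.b ^ p.k *
    ((lit hP γ.v ^ p.q)⁻¹ * (lit hP γ.u ^ (N : ℤ))⁻¹ * lit hP γ.v ^ p.q * lit hP γ.u ^ (N : ℤ)) *
    lit hP γ.z ^ p.l * lit hP γ.u ^ p.m * lit hP γ.v ^ p.r

/-- Scales together with exponents bounded linearly in terms of the scale. -/
abbrev NFIndex (K : ℕ) := {t : ℕ+ × NF // t.2.Bdd K t.1}

/-- The scale of an index. -/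
def NFIndex.scale {K : ℕ} (t : NFIndex K) : ℕ+ := t.1.1

/-- An exponent function on the index set. -/
def nfExp {K : ℕ} (f : NF → ℤ) (hf : ∀ {N p}, NF.Bdd K N p → |f p| ≤ K * N) :
    linExp (NFIndex.scale (K := K)) :=
  ⟨fun t => f t.1.2, K, fun t => by
    have := hf t.2
    zify
    exact this⟩

/-- The asymptotic class of the normal form words with the given families of exponents. -/
theorem exists_nfFam {ι : Type*} (n : ι → ℕ+) (i s c d k' q l m r : linExp n) :
    ∃ w : linFam k n, (w : Asy R n) = nf hP n γ i s c d k' q l m r ∧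
      ∀ t, w.1 t = nfWord hP γ (n t)
        ⟨i.1 t, s.1 t, c.1 t, d.1 t, k'.1 t, q.1 t, l.1 t, m.1 t, r.1 t⟩ := by
  let P : G → linExp n → linFam k n := fun g e => ⟨_, zpow_mem_linFam (lit hP g) e⟩
  exact ⟨P γ.x i * P γ.a (s - c - c) *
    ((P γ.x (scaleExp n))⁻¹ * P γ.a (c + d) * P γ.x (scaleExp n)) *
    (P γ.x (scaleExp n) * P γ.a (c - d) * (P γ.x (scaleExp n))⁻¹) * P γ.b k' *
    ((P γ.v q)⁻¹ * (P γ.u (scaleExp n))⁻¹ * P γ.v q * P γ.u (scaleExp n)) *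
    P γ.z l * P γ.u m * P γ.v r, rfl, fun t => rfl⟩

theorem exists_norm_nfWord_le (K : ℕ) : ∃ C, ∀ N p, 1 ≤ N → NF.Bdd K N p →
    (nfWord hP γ N p).norm ≤ C * N := by
  obtain ⟨w, -, hw⟩ := exists_nfFam hP γ (NFIndex.scale (K := K))
    (nfExp NF.i NF.Bdd.i) (nfExp NF.s NF.Bdd.s) (nfExp NF.c NF.Bdd.c) (nfExp NF.d NF.Bdd.d)
    (nfExp NF.k NF.Bdd.k) (nfExp NF.q NF.Bdd.q) (nfExp NF.l NF.Bdd.l) (nfExp NF.m NF.Bdd.m)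
    (nfExp NF.r NF.Bdd.r)
  obtain ⟨C, hC⟩ := w.2
  refine ⟨C, fun N p hN hp => ?_⟩
  have := hC ⟨(⟨N, hN⟩, p), hp⟩
  rwa [hw] at this

/-- An identity between classes of normal form words gives a uniform filling estimate. -/
theorem exists_near_of_nf_mul_eq (K : ℕ) (g : G) {n : NFIndex K → ℕ+} (hn : n = NFIndex.scale)
    {i s c d k' q l m r i' s' c' d' k'' q' l' m' r' : linExp n}
    (h : nf hP n γ i s c d k' q l m r * pw hP g (constExp n 1) =
      nf hP n γ i' s' c' d' k'' q' l' m' r') :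
    ∃ C, ∀ N p, ∀ hN : 1 ≤ N, ∀ hp : NF.Bdd K N p, ∀ t : NFIndex K, t = ⟨(⟨N, hN⟩, p), hp⟩ →
      Near R (C * N ^ 2) (C * N)
        (nfWord hP γ N ⟨i.1 t, s.1 t, c.1 t, d.1 t, k'.1 t, q.1 t, l.1 t, m.1 t, r.1 t⟩ * lit hP g)
        (nfWord hP γ N
          ⟨i'.1 t, s'.1 t, c'.1 t, d'.1 t, k''.1 t, q'.1 t, l'.1 t, m'.1 t, r'.1 t⟩) := by
  obtain ⟨w, hw, hw1⟩ := exists_nfFam hP γ n i s c d k' q l m r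
  obtain ⟨w', hw', hw1'⟩ := exists_nfFam hP γ n i' s' c' d' k'' q' l' m' r'
  rw [← hw, ← hw'] at h
  obtain ⟨C, hC⟩ := asy_eq_iff.1 ((QuotientGroup.mk_mul _ _ _).trans h)
  refine ⟨C, ?_⟩
  rintro N p hN hp t ht
  have := hC t
  rw [hw1'] at this
  change Near R _ _ (w.1 t * _ ^ (1 : ℤ)) _ at this
  rw [zpow_one, hw1] at this
  subst hn ht
  exact this

/-- Right multiplication of normal form words of exponents up to `K N` by `g` changes the exponents
by `f`, at quadratic cost. -/
def MulBound (K : ℕ) (g : G) (f : ℕ → NF → NF) : Prop :=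
  ∃ C, ∀ N p, 1 ≤ N → NF.Bdd K N p →
    Near R (C * N ^ 2) (C * N) (nfWord hP γ N p * lit hP g) (nfWord hP γ N (f N p))

local notation "fi" => nfExp NF.i NF.Bdd.i
local notation "fs" => nfExp NF.s NF.Bdd.s
local notation "fc" => nfExp NF.c NF.Bdd.c
local notation "fd" => nfExp NF.d NF.Bdd.d
local notation "fk" => nfExp NF.k NF.Bdd.k
local notation "fq" => nfExp NF.q NF.Bdd.q
local notation "fl" => nfExp NF.l NF.Bdd.l
local notation "fm" => nfExp NF.m NF.Bdd.m
local notation "fr" => nfExp NF.r NF.Bdd.r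

theorem mulBound_x (K : ℕ) : MulBound hP γ K γ.x fun _ => NF.mulX := by
  obtain ⟨C, hC⟩ := exists_near_of_nf_mul_eq hP γ K γ.x rfl
    (nf_mul_x hP γ fi fs fc fd fk fq fl fm fr)
  refine ⟨C, fun N p hN hp => ?_⟩
  have := hC N p hN hp _ rfl
  change Near R _ _ _ (nfWord hP γ N (NF.mulX p))
  rw [NF.mulX]
  exact this

theorem mulBound_a (K : ℕ) : MulBound hP γ K γ.a fun _ => NF.mulA 1 := by
  obtain ⟨C, hC⟩ := exists_near_of_nf_mul_eq hP γ K γ.a rfl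
    (nf_mul_a hP γ fi fs fc fd fk fq fl fm fr)
  refine ⟨C, fun N p hN hp => ?_⟩
  have := hC N p hN hp _ rfl
  change Near R _ _ _ (nfWord hP γ N (NF.mulA 1 p))
  rw [NF.mulA]
  exact this

theorem mulBound_b (K : ℕ) : MulBound hP γ K γ.b fun _ => NF.mulB 1 := by
  obtain ⟨C, hC⟩ := exists_near_of_nf_mul_eq hP γ K γ.b rfl
    (nf_mul_b hP γ fi fs fc fd fk fq fl fm fr)
  refine ⟨C, fun N p hN hp => ?_⟩
  have := hC N p hN hp _ rfl
  change Near R _ _ _ (nfWord hP γ N (NF.mulB 1 p))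
  rw [NF.mulB]
  exact this

theorem mulBound_z (K : ℕ) : MulBound hP γ K γ.z fun _ => NF.mulZ 1 := by
  obtain ⟨C, hC⟩ := exists_near_of_nf_mul_eq hP γ K γ.z rfl
    (nf_mul_z hP γ fi fs fc fd fk fq fl fm fr)
  refine ⟨C, fun N p hN hp => ?_⟩
  have := hC N p hN hp _ rfl
  change Near R _ _ _ (nfWord hP γ N (NF.mulZ 1 p))
  rw [NF.mulZ]
  exact this

theorem mulBound_u (K : ℕ) : MulBound hP γ K γ.u fun _ => NF.mulU := by
  obtain ⟨C, hC⟩ := exists_near_of_nf_mul_eq hP γ K γ.u rfl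
    (nf_mul_u hP γ fi fs fc fd fk fq fl fm fr)
  refine ⟨C, fun N p hN hp => ?_⟩
  have := hC N p hN hp _ rfl
  change Near R _ _ _ (nfWord hP γ N (NF.mulU p))
  rw [NF.mulU]
  exact this

theorem mulBound_v (K : ℕ) : MulBound hP γ K γ.v fun _ => NF.mulV 1 := by
  obtain ⟨C, hC⟩ := exists_near_of_nf_mul_eq hP γ K γ.v rfl
    (nf_mul_v hP γ fi fs fc fd fk fq fl fm fr)
  refine ⟨C, fun N p hN hp => ?_⟩
  have := hC N p hN hp _ rfl
  change Near R _ _ _ (nfWord hP γ N (NF.mulV 1 p))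
  rw [NF.mulV]
  exact this

/-- Normal form words of exponents up to `K N` change at quadratic cost when the exponents are
changed by `f`. -/
def CarryBound (K : ℕ) (f : ℕ → NF → NF) : Prop :=
  ∃ C, ∀ N p, 1 ≤ N → NF.Bdd K N p →
    Near R (C * N ^ 2) (C * N) (nfWord hP γ N p) (nfWord hP γ N (f N p))

/-- Carries are handled as multiplications by `1`. -/
theorem carryBound_of_mulBound {K : ℕ} {f : ℕ → NF → NF} (h : MulBound hP γ K 1 f) :
    CarryBound hP γ K f := by
  obtain ⟨C, hC⟩ := h
  obtain ⟨A, hA⟩ := exists_norm_nfWord_le hP γ K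
  obtain ⟨B, hB⟩ := exists_near hP (g := 1) (h := lit hP (1 : G))
    (by simp [lit, lift_surjInv hP])
  refine ⟨B + C + A, fun N p hN hp => ?_⟩
  have h1 := hB.mul_left (nfWord hP γ N p)
  rw [mul_one] at h1
  refine ((h1.mono le_rfl ?_).trans ((hC N p hN hp).mono le_rfl ?_)).mono ?_ le_rfl
  · have := hA N p hN hp
    nlinarith
  · nlinarith
  · have : 1 ≤ N ^ 2 := Nat.one_le_pow _ _ hN
    nlinarith

theorem carryBound_carryZ (K : ℕ) : CarryBound hP γ K (NF.carryZ 1) := by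
  have h := nf_carry_z hP γ (n := NFIndex.scale (K := K)) fi fs fc fd fk fq fl fm fr
  rw [← mul_one (nf _ _ _ _ _ _ _ _ _ _ _ _), ← pw_one hP (constExp _ 1)] at h
  obtain ⟨C, hC⟩ := exists_near_of_nf_mul_eq hP γ K 1 rfl h
  refine carryBound_of_mulBound hP γ ⟨C, fun N p hN hp => ?_⟩
  have := hC N p hN hp _ rfl
  rwa [NF.carryZ, one_mul]

theorem carryBound_carryQ (K : ℕ) : CarryBound hP γ K (NF.carryQ 1) := by
  have h := nf_carry_n2 hP γ (n := NFIndex.scale (K := K)) fi fs fc fd fk fq fl fm fr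
  rw [← mul_one (nf _ _ _ _ _ _ _ _ _ _ _ _), ← pw_one hP (constExp _ 1)] at h
  obtain ⟨C, hC⟩ := exists_near_of_nf_mul_eq hP γ K 1 rfl h
  refine carryBound_of_mulBound hP γ ⟨C, fun N p hN hp => ?_⟩
  have := hC N p hN hp _ rfl
  rwa [NF.carryQ, one_mul]

theorem carryBound_carryB (K : ℕ) : CarryBound hP γ K (NF.carryB 1) := by
  have h := nf_carry_b hP γ (n := NFIndex.scale (K := K)) fi fs fc fd fk fq fl fm fr
  rw [← mul_one (nf _ _ _ _ _ _ _ _ _ _ _ _), ← pw_one hP (constExp _ 1)] at h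
  obtain ⟨C, hC⟩ := exists_near_of_nf_mul_eq hP γ K 1 rfl h
  refine carryBound_of_mulBound hP γ ⟨C, fun N p hN hp => ?_⟩
  have := hC N p hN hp _ rfl
  rwa [NF.carryB, one_mul, one_mul]

end Words

/-! ### Reducing words to normal form -/

/-- A number of size `(T + 1) N` is reduced to size `N` by at most `T` multiples of `N`. -/
theorem exists_abs_sub_mul_le {N : ℤ} (hN : 0 ≤ N) (T : ℕ) {y : ℤ} (hy : |y| ≤ (T + 1) * N) :
    ∃ t : ℤ, |t| ≤ T ∧ |y - t * N| ≤ N := by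
  induction T generalizing y with
  | zero => exact ⟨0, by simp, by simpa using hy⟩
  | succ T ih =>
    push_cast at hy
    rw [abs_le] at hy
    by_cases h1 : |y| ≤ (T + 1) * N
    · obtain ⟨t, ht, ht'⟩ := ih h1
      exact ⟨t, by push_cast; linarith, ht'⟩
    · have hT : 0 ≤ (T : ℤ) * N := by positivity
      rcases le_or_gt 0 y with hy0 | hy0
      · rw [abs_of_nonneg hy0] at h1
        obtain ⟨t, ht, ht'⟩ := ih (y := y - N) (by rw [abs_le]; constructor <;> linarith)
        refine ⟨t + 1, ?_, by rwa [add_mul, one_mul, add_comm (t * N), ← sub_sub]⟩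
        rw [abs_le] at ht ⊢
        push_cast
        constructor <;> linarith
      · rw [abs_of_neg hy0] at h1
        obtain ⟨t, ht, ht'⟩ := ih (y := y + N) (by rw [abs_le]; constructor <;> linarith)
        refine ⟨t - 1, ?_, by rwa [sub_mul, one_mul, sub_sub_eq_add_sub]⟩
        rw [abs_le] at ht ⊢
        push_cast
        constructor <;> linarith

namespace NF

/-- The bounds on the exponents of the normal form word of scale `N` of a product of `j`
generators. Each multiplication is followed by at most five carries into `c`, which leaves room in
the factor `20`. -/
structure Inv (N j : ℕ) (p : NF) : Prop where
  i : |p.i| ≤ j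
  s : |p.s| ≤ j
  c : |p.c| ≤ 20 * j
  d : |p.d| ≤ j
  k : |p.k| ≤ N
  q : |p.q| ≤ N
  l : |p.l| ≤ N
  m : |p.m| ≤ j
  r : |p.r| ≤ j

theorem Inv.mono {N j j' : ℕ} {p : NF} (h : p.Inv N j) (hj : j ≤ j') : p.Inv N j' := by
  have h1 : (j : ℤ) ≤ j' := by exact_mod_cast hj
  exact ⟨h.i.trans h1, h.s.trans h1, h.c.trans (by linarith), h.d.trans h1, h.k, h.q, h.l,
    h.m.trans h1, h.r.trans h1⟩

/-- The bounds on the exponents after one more multiplication, before carrying. -/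
structure Raw (N j : ℕ) (p : NF) : Prop where
  i : |p.i| ≤ j + 1
  s : |p.s| ≤ j + 1
  c : |p.c| ≤ 20 * j
  d : |p.d| ≤ j
  k : |p.k| ≤ 2 * N
  q : |p.q| ≤ 3 * N
  l : |p.l| ≤ 3 * N
  m : |p.m| ≤ j + 1
  r : |p.r| ≤ j + 1

/-- The words that occur have exponents up to `50 N`; intermediate stages of a carry or of an
inverse step stay below `100 N` and `200 N`. -/
theorem Inv.bdd {N j : ℕ} {p : NF} (h : p.Inv N j) (hj : j ≤ N) : p.Bdd 50 N := by
  have h1 : (j : ℤ) ≤ N := by exact_mod_cast hj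
  obtain ⟨hi, hs, hc, hd, hk, hq, hl, hm, hr⟩ := h
  constructor <;> push_cast <;> linarith

theorem Raw.bdd {N j : ℕ} {p : NF} (h : p.Raw N j) (hj : j + 1 ≤ N) : p.Bdd 50 N := by
  have h1 : (j : ℤ) + 1 ≤ N := by exact_mod_cast hj
  obtain ⟨hi, hs, hc, hd, hk, hq, hl, hm, hr⟩ := h
  constructor <;> push_cast <;> linarith

theorem eval_carryZ (t : ℤ) (N : ℕ) (p : NF) : (carryZ t N p).eval N = p.eval N := by
  ext <;> simp only [eval, carryZ]; ring

theorem eval_carryQ (t : ℤ) (N : ℕ) (p : NF) : (carryQ t N p).eval N = p.eval N := by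
  ext <;> simp only [eval, carryQ]; ring

theorem eval_carryB (t : ℤ) (N : ℕ) (p : NF) : (carryB t N p).eval N = p.eval N := by
  ext <;> simp only [eval, carryB] <;> ring

theorem abs_mul_le_of_le_six {t : ℤ} (ht : |t| ≤ 6) (N : ℕ) : |t * N| ≤ 6 * N := by
  rw [abs_mul, Nat.abs_cast]
  gcongr

theorem Bdd.carryZ {N : ℕ} (hN : 1 ≤ N) {p : NF} (h : p.Bdd 50 N) {t : ℤ} (ht : |t| ≤ 6) :
    (carryZ t N p).Bdd 100 N := by
  have h1 := abs_mul_le_of_le_six ht N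
  have h2 : (1 : ℤ) ≤ N := by exact_mod_cast hN
  obtain ⟨hi, hs, hc, hd, hk, hq, hl, hm, hr⟩ := h
  simp only [abs_le] at *
  constructor <;> simp only [NF.carryZ, abs_le] <;> push_cast at * <;> constructor <;> linarith

theorem Bdd.carryQ {N : ℕ} (hN : 1 ≤ N) {p : NF} (h : p.Bdd 50 N) {t : ℤ} (ht : |t| ≤ 6) :
    (carryQ t N p).Bdd 100 N := by
  have h1 := abs_mul_le_of_le_six ht N
  have h2 : (1 : ℤ) ≤ N := by exact_mod_cast hN
  obtain ⟨hi, hs, hc, hd, hk, hq, hl, hm, hr⟩ := h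
  simp only [abs_le] at *
  constructor <;> simp only [NF.carryQ, abs_le] <;> push_cast at * <;> constructor <;> linarith

theorem Bdd.carryB {N : ℕ} (hN : 1 ≤ N) {p : NF} (h : p.Bdd 50 N) {t : ℤ} (ht : |t| ≤ 6) :
    (carryB t N p).Bdd 100 N := by
  have h1 := abs_mul_le_of_le_six ht N
  have h2 : (1 : ℤ) ≤ N := by exact_mod_cast hN
  obtain ⟨hi, hs, hc, hd, hk, hq, hl, hm, hr⟩ := h
  simp only [abs_le] at *
  constructor <;> simp only [NF.carryB, abs_le, mul_add] <;> push_cast at * <;> constructor <;>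
    linarith

end NF

section Reduction

variable {k : ℕ} {R : Set (FreeGroup (Fin k))} {G : Type*} [Group G] {s : Fin k → G}
  (hP : IsFinitePresentation s R) (γ : Frame G)

/-- A boundedly iterated carry has quadratic cost. -/
theorem exists_near_iterate {act : ℤ → ℕ → NF → NF} (h0 : ∀ N p, act 0 N p = p)
    (hadd : ∀ t N p, act 1 N (act t N p) = act (t + 1) N p)
    (hb : ∀ t N p, 1 ≤ N → |t| ≤ 6 → p.Bdd 50 N → (act t N p).Bdd 100 N)
    (h1 : CarryBound hP γ 100 (act 1)) :
    ∃ C, ∀ N p, 1 ≤ N → p.Bdd 50 N → ∀ t : ℤ, |t| ≤ 6 →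
      Near R (C * N ^ 2) (C * N) (nfWord hP γ N p) (nfWord hP γ N (act t N p)) := by
  obtain ⟨C, hC⟩ := h1
  refine ⟨6 * C, fun N p hN hp => ?_⟩
  have key : ∀ T : ℕ, T ≤ 6 → ∀ t : ℤ, |t| ≤ T →
      Near R (T * (C * N ^ 2)) (C * N) (nfWord hP γ N p) (nfWord hP γ N (act t N p)) := by
    intro T
    induction T with
    | zero =>
      intro _ t ht
      obtain rfl : t = 0 := by simpa using ht
      rw [h0]
      exact Near.refl _
    | succ T ih =>
      intro hT t ht
      have hstep : ∀ t : ℤ, |t| ≤ 6 → Near R (C * N ^ 2) (C * N) (nfWord hP γ N (act t N p))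
          (nfWord hP γ N (act (t + 1) N p)) := fun t ht => by
        rw [← hadd]
        exact hC N _ hN (hb t N p hN ht hp)
      push_cast at ht
      have hT' : (T : ℤ) + 1 ≤ 6 := by exact_mod_cast hT
      rw [abs_le] at ht
      rcases lt_trichotomy t 0 with h | rfl | h
      · have h2 := (ih (by omega) (t + 1) (by rw [abs_le]; constructor <;> linarith)).trans
          (hstep t (by rw [abs_le]; constructor <;> linarith)).symm
        exact h2.mono (by rw [add_mul, one_mul]) le_rfl
      · rw [h0]; exact Near.refl _
      · have h2 := (ih (by omega) (t - 1) (by rw [abs_le]; constructor <;> linarith)).trans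
          (hstep (t - 1) (by rw [abs_le]; constructor <;> linarith))
        rw [sub_add_cancel] at h2
        exact h2.mono (by rw [add_mul, one_mul]) le_rfl
  intro t ht
  refine (key 6 le_rfl t (by exact_mod_cast ht)).mono (by rw [mul_assoc]) ?_
  gcongr
  omega

theorem exists_near_carryZ : ∃ C, ∀ N p, 1 ≤ N → p.Bdd 50 N → ∀ t : ℤ, |t| ≤ 6 →
    Near R (C * N ^ 2) (C * N) (nfWord hP γ N p) (nfWord hP γ N (NF.carryZ t N p)) :=
  exists_near_iterate hP γ (fun N p => by simp [NF.carryZ])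
    (fun t N p => by ext <;> simp only [NF.carryZ] <;> ring)
    (fun t N p hN ht hp => hp.carryZ hN ht) (carryBound_carryZ hP γ 100)

theorem exists_near_carryQ : ∃ C, ∀ N p, 1 ≤ N → p.Bdd 50 N → ∀ t : ℤ, |t| ≤ 6 →
    Near R (C * N ^ 2) (C * N) (nfWord hP γ N p) (nfWord hP γ N (NF.carryQ t N p)) :=
  exists_near_iterate hP γ (fun N p => by simp [NF.carryQ])
    (fun t N p => by ext <;> simp only [NF.carryQ] <;> ring)
    (fun t N p hN ht hp => hp.carryQ hN ht) (carryBound_carryQ hP γ 100)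

theorem exists_near_carryB : ∃ C, ∀ N p, 1 ≤ N → p.Bdd 50 N → ∀ t : ℤ, |t| ≤ 6 →
    Near R (C * N ^ 2) (C * N) (nfWord hP γ N p) (nfWord hP γ N (NF.carryB t N p)) :=
  exists_near_iterate hP γ (fun N p => by simp [NF.carryB])
    (fun t N p => by ext <;> simp only [NF.carryB] <;> ring)
    (fun t N p hN ht hp => hp.carryB hN ht) (carryBound_carryB hP γ 100)

/-- Carrying brings the exponents back into the range of the normal form. -/
theorem exists_normalize : ∃ C, ∀ N j p, j + 1 ≤ N → NF.Raw N j p →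
    ∃ p' : NF, p'.Inv N (j + 1) ∧ p'.eval N = p.eval N ∧
      Near R (C * N ^ 2) (C * N) (nfWord hP γ N p) (nfWord hP γ N p') := by
  obtain ⟨C₁, h₁⟩ := exists_near_carryB hP γ
  obtain ⟨C₂, h₂⟩ := exists_near_carryZ hP γ
  obtain ⟨C₃, h₃⟩ := exists_near_carryQ hP γ
  refine ⟨C₁ + C₂ + C₃, fun N j p hj hp => ?_⟩
  have hN : 1 ≤ N := by omega
  have hNz : (1 : ℤ) ≤ N := by exact_mod_cast hN
  have hjz : (j : ℤ) + 1 ≤ N := by exact_mod_cast hj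
  have hj0 : (0 : ℤ) ≤ j := by positivity
  have hb := hp.bdd hj
  obtain ⟨hi, hs, hc, hd, hk, hq, hl, hm, hr⟩ := hp
  obtain ⟨t, ht, hkt⟩ : ∃ t : ℤ, |t| ≤ 1 ∧ |p.k - t * (N + N)| ≤ N := by
    rw [abs_le] at hk
    rcases lt_or_ge (p.k) (-N) with h | h
    · exact ⟨-1, by simp, by rw [abs_le]; constructor <;> linarith⟩
    rcases le_or_gt (p.k) N with h' | h'
    · exact ⟨0, by simp, by rw [abs_le]; constructor <;> linarith⟩
    · exact ⟨1, by simp, by rw [abs_le]; constructor <;> linarith⟩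
  have n1 := h₁ N p hN hb t (by linarith)
  set p₁ := NF.carryB t N p with hp₁
  have htN : |t * (N : ℤ)| ≤ N := by
    rw [abs_mul, Nat.abs_cast]
    exact mul_le_of_le_one_left (by positivity) ht
  have hl₁ : |p₁.l| ≤ (3 + 1) * N := by
    refine (abs_add_le _ _).trans ?_
    linarith
  have hd₁ : |p₁.d| ≤ j + 1 := (abs_add_le _ _).trans (by linarith)
  have hb₁ : p₁.Bdd 50 N := by
    constructor <;> simp only [hp₁, NF.carryB] <;> push_cast <;>
      first | linarith | exact hl₁.trans (by linarith) | exact hd₁.trans (by linarith)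
  obtain ⟨t', ht', hlt⟩ := exists_abs_sub_mul_le (by linarith) 3 hl₁
  have n2 := h₂ N p₁ hN hb₁ t' (by push_cast at ht'; linarith)
  set p₂ := NF.carryZ t' N p₁ with hp₂
  have hq₂ : |p₂.q| ≤ (5 + 1) * N := by
    refine (abs_add_le _ _).trans ?_
    simp only [hp₁, NF.carryB]
    push_cast at ht'
    linarith
  have hb₂ : p₂.Bdd 50 N := by
    exact ⟨hb₁.i, hb₁.s, hb₁.c, hb₁.d, hb₁.k, hq₂.trans (by push_cast; linarith),
      hlt.trans (by push_cast; linarith), hb₁.m, hb₁.r⟩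
  obtain ⟨t'', ht'', hqt⟩ := exists_abs_sub_mul_le (by linarith) 5 hq₂
  have n3 := h₃ N p₂ hN hb₂ t'' (by push_cast at ht''; linarith)
  refine ⟨NF.carryQ t'' N p₂, ?_, ?_, ?_⟩
  · push_cast at ht''
    have hc₂ : |p₂.c + t''| ≤ 20 * (j + 1) :=
      (abs_add_le _ _).trans (by simp only [hp₂, hp₁, NF.carryZ, NF.carryB]; linarith)
    exact ⟨by push_cast; exact hi, by push_cast; exact hs, by push_cast; exact hc₂,
      by push_cast; exact hd₁, hkt, hqt, hlt, by push_cast; exact hm, by push_cast; exact hr⟩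
  · rw [NF.eval_carryQ, hp₂, NF.eval_carryZ, hp₁, NF.eval_carryB]
  · refine (((n1.mono le_rfl ?_).trans (n2.mono le_rfl ?_)).trans (n3.mono le_rfl ?_)).mono ?_ le_rfl
    · exact Nat.mul_le_mul_right _ (by omega)
    · exact Nat.mul_le_mul_right _ (by omega)
    · exact Nat.mul_le_mul_right _ (by omega)
    · rw [add_mul, add_mul]

/-- An inverse letter undoes the multiplication by the letter. -/
theorem MulBound.inv {K K' : ℕ} {g : G} {f f' : ℕ → NF → NF} (h : MulBound hP γ K' g f)
    (hff : ∀ N p, f N (f' N p) = p) (hb : ∀ N p, 1 ≤ N → p.Bdd K N → (f' N p).Bdd K' N) :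
    MulBound hP γ K g⁻¹ f' := by
  obtain ⟨C, hC⟩ := h
  obtain ⟨A, hA⟩ := exists_norm_nfWord_le hP γ K'
  obtain ⟨B, hB⟩ := exists_near hP (g := lit hP g * lit hP g⁻¹) (h := 1)
    (by simp [lit, lift_surjInv hP])
  refine ⟨B + C + A, fun N p hN hp => ?_⟩
  have h1 := hB.mul_left (nfWord hP γ N (f' N p))
  have h2 := (hC N _ hN (hb N p hN hp)).mul_right (lit hP g⁻¹)
  rw [hff, mul_assoc] at h2
  rw [mul_one] at h1
  have hN2 : 1 ≤ N ^ 2 := Nat.one_le_pow _ _ hN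
  refine ((h2.symm.mono le_rfl ?_).trans (h1.mono le_rfl ?_)).mono ?_ le_rfl
  · nlinarith
  · have := hA N _ hN (hb N p hN hp)
    nlinarith
  · nlinarith

/-- Right multiplication by `g`, before carrying, is realised on the exponents of normal form words
at quadratic cost. -/
def HasStep (φ : G →* Model) (g : G) : Prop :=
  ∃ f : ℕ → NF → NF, MulBound hP γ 50 g f ∧ (∀ N j p, j + 1 ≤ N → NF.Inv N j p → (f N p).Raw N j) ∧
    ∀ N p, (f N p).eval N = p.eval N * φ g

/-- The homomorphism to the model group maps the generators as expected. -/
structure Frame.IsModelHom (φ : G →* Model) : Prop where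
  x : φ γ.x = Model.x
  a : φ γ.a = Model.a
  b : φ γ.b = Model.b
  z : φ γ.z = Model.z
  u : φ γ.u = Model.u
  v : φ γ.v = Model.v

variable {γ} {φ : G →* Model} (hφ : γ.IsModelHom φ)
include hφ

omit hφ in
theorem HasStep.of_inv {g : G} {f f' : ℕ → NF → NF} (h : MulBound hP γ 200 g f)
    (hff : ∀ N p, f N (f' N p) = p) (hb : ∀ N p, 1 ≤ N → p.Bdd 50 N → (f' N p).Bdd 200 N)
    (hr : ∀ N j p, j + 1 ≤ N → NF.Inv N j p → (f' N p).Raw N j)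
    (he : ∀ N p, (f N p).eval N = p.eval N * φ g) : HasStep hP γ φ g⁻¹ :=
  ⟨f', h.inv hP γ hff hb, hr, fun N p => by rw [map_inv, eq_mul_inv_iff_mul_eq, ← he, hff]⟩

theorem hasStep_x : HasStep hP γ φ γ.x ∧ HasStep hP γ φ γ.x⁻¹ := by
  have he : ∀ N p, (NF.mulX p).eval N = p.eval N * φ γ.x := fun N p => by
    rw [hφ.x]; ext <;> simp only [NF.eval, NF.mulX, Model.mul_def, Model.x] <;> ring
  refine ⟨⟨_, mulBound_x hP γ 50, ?_, he⟩,
    HasStep.of_inv hP (f' := fun _ => NF.mulXInv) (mulBound_x hP γ 200) ?_ ?_ ?_ he⟩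
  · intro N j p hj ⟨hi, hs, hc, hd, hk, hq, hl, hm, hr⟩
    have hjz : (j : ℤ) + 1 ≤ N := by exact_mod_cast hj
    simp only [abs_le] at *
    constructor <;> simp only [NF.mulX, abs_le] <;> constructor <;> linarith
  · intro N p
    ext <;> simp only [NF.mulX, NF.mulXInv] <;> ring
  · intro N p hN ⟨hi, hs, hc, hd, hk, hq, hl, hm, hr⟩
    have hNz : (1 : ℤ) ≤ N := by exact_mod_cast hN
    simp only [abs_le] at *
    constructor <;> simp only [NF.mulXInv, abs_le] <;> push_cast at * <;> constructor <;> linarith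
  · intro N j p hj ⟨hi, hs, hc, hd, hk, hq, hl, hm, hr⟩
    have hjz : (j : ℤ) + 1 ≤ N := by exact_mod_cast hj
    simp only [abs_le] at *
    constructor <;> simp only [NF.mulXInv, abs_le] <;> constructor <;> linarith

theorem hasStep_u : HasStep hP γ φ γ.u ∧ HasStep hP γ φ γ.u⁻¹ := by
  have he : ∀ N p, (NF.mulU p).eval N = p.eval N * φ γ.u := fun N p => by
    rw [hφ.u]; ext <;> simp only [NF.eval, NF.mulU, Model.mul_def, Model.u] <;> ring
  refine ⟨⟨_, mulBound_u hP γ 50, ?_, he⟩,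
    HasStep.of_inv hP (f' := fun _ => NF.mulUInv) (mulBound_u hP γ 200) ?_ ?_ ?_ he⟩
  · intro N j p hj ⟨hi, hs, hc, hd, hk, hq, hl, hm, hr⟩
    have hjz : (j : ℤ) + 1 ≤ N := by exact_mod_cast hj
    simp only [abs_le] at *
    constructor <;> simp only [NF.mulU, abs_le] <;> constructor <;> linarith
  · intro N p
    ext <;> simp only [NF.mulU, NF.mulUInv] <;> ring
  · intro N p hN ⟨hi, hs, hc, hd, hk, hq, hl, hm, hr⟩
    have hNz : (1 : ℤ) ≤ N := by exact_mod_cast hN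
    simp only [abs_le] at *
    constructor <;> simp only [NF.mulUInv, abs_le] <;> push_cast at * <;> constructor <;> linarith
  · intro N j p hj ⟨hi, hs, hc, hd, hk, hq, hl, hm, hr⟩
    have hjz : (j : ℤ) + 1 ≤ N := by exact_mod_cast hj
    simp only [abs_le] at *
    constructor <;> simp only [NF.mulUInv, abs_le] <;> constructor <;> linarith

theorem hasStep_a : HasStep hP γ φ γ.a ∧ HasStep hP γ φ γ.a⁻¹ := by
  have hr : ∀ e : ℤ, |e| ≤ 1 → ∀ N j p, j + 1 ≤ N → NF.Inv N j p → (NF.mulA e p).Raw N j := by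
    intro e he N j p hj ⟨hi, hs, hc, hd, hk, hq, hl, hm, hr⟩
    have hjz : (j : ℤ) + 1 ≤ N := by exact_mod_cast hj
    simp only [abs_le] at *
    constructor <;> simp only [NF.mulA, abs_le] <;> constructor <;> linarith
  have he : ∀ N p, (NF.mulA 1 p).eval N = p.eval N * φ γ.a := fun N p => by
    rw [hφ.a]; ext <;> simp only [NF.eval, NF.mulA, Model.mul_def, Model.a] <;> ring
  refine ⟨⟨_, mulBound_a hP γ 50, hr 1 (by simp), he⟩,
    HasStep.of_inv hP (f' := fun _ => NF.mulA (-1)) (mulBound_a hP γ 200) ?_ ?_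
      (hr (-1) (by simp)) he⟩
  · intro N p
    ext <;> simp only [NF.mulA]
    ring
  · intro N p hN ⟨hi, hs, hc, hd, hk, hq, hl, hm, hr⟩
    have hNz : (1 : ℤ) ≤ N := by exact_mod_cast hN
    simp only [abs_le] at *
    constructor <;> simp only [NF.mulA, abs_le] <;> push_cast at * <;> constructor <;> linarith

theorem hasStep_b : HasStep hP γ φ γ.b ∧ HasStep hP γ φ γ.b⁻¹ := by
  have hr : ∀ e : ℤ, |e| ≤ 1 → ∀ N j p, j + 1 ≤ N → NF.Inv N j p → (NF.mulB e p).Raw N j := by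
    intro e he N j p hj ⟨hi, hs, hc, hd, hk, hq, hl, hm, hr⟩
    have hjz : (j : ℤ) + 1 ≤ N := by exact_mod_cast hj
    simp only [abs_le] at *
    constructor <;> simp only [NF.mulB, abs_le] <;> constructor <;> linarith
  have he : ∀ N p, (NF.mulB 1 p).eval N = p.eval N * φ γ.b := fun N p => by
    rw [hφ.b]; ext <;> simp only [NF.eval, NF.mulB, Model.mul_def, Model.b] <;> ring
  refine ⟨⟨_, mulBound_b hP γ 50, hr 1 (by simp), he⟩,
    HasStep.of_inv hP (f' := fun _ => NF.mulB (-1)) (mulBound_b hP γ 200) ?_ ?_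
      (hr (-1) (by simp)) he⟩
  · intro N p
    ext <;> simp only [NF.mulB]
    ring
  · intro N p hN ⟨hi, hs, hc, hd, hk, hq, hl, hm, hr⟩
    have hNz : (1 : ℤ) ≤ N := by exact_mod_cast hN
    simp only [abs_le] at *
    constructor <;> simp only [NF.mulB, abs_le] <;> push_cast at * <;> constructor <;> linarith

theorem hasStep_z : HasStep hP γ φ γ.z ∧ HasStep hP γ φ γ.z⁻¹ := by
  have hr : ∀ e : ℤ, |e| ≤ 1 → ∀ N j p, j + 1 ≤ N → NF.Inv N j p → (NF.mulZ e p).Raw N j := by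
    intro e he N j p hj ⟨hi, hs, hc, hd, hk, hq, hl, hm, hr⟩
    have hjz : (j : ℤ) + 1 ≤ N := by exact_mod_cast hj
    simp only [abs_le] at *
    constructor <;> simp only [NF.mulZ, abs_le] <;> constructor <;> linarith
  have he : ∀ N p, (NF.mulZ 1 p).eval N = p.eval N * φ γ.z := fun N p => by
    rw [hφ.z]; ext <;> simp only [NF.eval, NF.mulZ, Model.mul_def, Model.z] <;> ring
  refine ⟨⟨_, mulBound_z hP γ 50, hr 1 (by simp), he⟩,
    HasStep.of_inv hP (f' := fun _ => NF.mulZ (-1)) (mulBound_z hP γ 200) ?_ ?_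
      (hr (-1) (by simp)) he⟩
  · intro N p
    ext <;> simp only [NF.mulZ]
    ring
  · intro N p hN ⟨hi, hs, hc, hd, hk, hq, hl, hm, hr⟩
    have hNz : (1 : ℤ) ≤ N := by exact_mod_cast hN
    simp only [abs_le] at *
    constructor <;> simp only [NF.mulZ, abs_le] <;> push_cast at * <;> constructor <;> linarith

theorem hasStep_v : HasStep hP γ φ γ.v ∧ HasStep hP γ φ γ.v⁻¹ := by
  have hr : ∀ e : ℤ, |e| ≤ 1 → ∀ N j p, j + 1 ≤ N → NF.Inv N j p → (NF.mulV e p).Raw N j := by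
    intro e he N j p hj ⟨hi, hs, hc, hd, hk, hq, hl, hm, hr⟩
    have hjz : (j : ℤ) + 1 ≤ N := by exact_mod_cast hj
    simp only [abs_le] at *
    constructor <;> simp only [NF.mulV, abs_le] <;> constructor <;> linarith
  have he : ∀ N p, (NF.mulV 1 p).eval N = p.eval N * φ γ.v := fun N p => by
    rw [hφ.v]; ext <;> simp only [NF.eval, NF.mulV, Model.mul_def, Model.v] <;> ring
  refine ⟨⟨_, mulBound_v hP γ 50, hr 1 (by simp), he⟩,
    HasStep.of_inv hP (f' := fun _ => NF.mulV (-1)) (mulBound_v hP γ 200) ?_ ?_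
      (hr (-1) (by simp)) he⟩
  · intro N p
    ext <;> simp only [NF.mulV]
    ring
  · intro N p hN ⟨hi, hs, hc, hd, hk, hq, hl, hm, hr⟩
    have hNz : (1 : ℤ) ≤ N := by exact_mod_cast hN
    simp only [abs_le] at *
    constructor <;> simp only [NF.mulV, abs_le] <;> push_cast at * <;> constructor <;> linarith

/-- Every letter can be multiplied onto a normal form word. -/
theorem hasStep_of_letter {g : G} (hg : g ∈ ({γ.x, γ.a, γ.b, γ.z, γ.u, γ.v} : Set G) ∨
    g⁻¹ ∈ ({γ.x, γ.a, γ.b, γ.z, γ.u, γ.v} : Set G)) : HasStep hP γ φ g := by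
  have key : ∀ h ∈ ({γ.x, γ.a, γ.b, γ.z, γ.u, γ.v} : Set G),
      HasStep hP γ φ h ∧ HasStep hP γ φ h⁻¹ := by
    rintro h (rfl | rfl | rfl | rfl | rfl | rfl)
    exacts [hasStep_x hP hφ, hasStep_a hP hφ, hasStep_b hP hφ, hasStep_z hP hφ, hasStep_u hP hφ,
      hasStep_v hP hφ]
  rcases hg with hg | hg
  · exact (key g hg).1
  · simpa using (key _ hg).2

/-- Multiplying a normal form word by a fixed product of letters. -/
theorem exists_nf_mul_list (L : List G)
    (hL : ∀ g ∈ L, g ∈ ({γ.x, γ.a, γ.b, γ.z, γ.u, γ.v} : Set G) ∨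
      g⁻¹ ∈ ({γ.x, γ.a, γ.b, γ.z, γ.u, γ.v} : Set G)) :
    ∃ C, ∀ N j p, j + L.length ≤ N → 1 ≤ N → NF.Inv N j p →
      ∃ p' : NF, p'.Inv N (j + L.length) ∧ p'.eval N = p.eval N * φ L.prod ∧
        Near R (C * N ^ 2) (C * N) (nfWord hP γ N p * (L.map (lit hP)).prod) (nfWord hP γ N p') := by
  induction L with
  | nil => exact ⟨0, fun N j p _ _ hp => ⟨p, hp, by simp, by simpa using Near.refl _⟩⟩
  | cons g L ih =>
    obtain ⟨C, hC⟩ := ih fun h hh => hL h (List.mem_cons_of_mem _ hh)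
    obtain ⟨f, ⟨C₁, h₁⟩, hraw, heval⟩ := hasStep_of_letter hP hφ (hL g List.mem_cons_self)
    obtain ⟨C₂, h₂⟩ := exists_normalize hP γ
    refine ⟨C₁ + C₂ + C, fun N j p hj hN hp => ?_⟩
    rw [List.length_cons] at hj
    have n1 := h₁ N p hN (hp.bdd (by omega))
    obtain ⟨p₁, hp₁, he₁, n2⟩ := h₂ N j _ (by omega) (hraw N j p (by omega) hp)
    obtain ⟨p₂, hp₂, he₂, n3⟩ := hC N (j + 1) p₁ (by omega) hN hp₁
    refine ⟨p₂, ?_, ?_, ?_⟩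
    · rw [List.length_cons, add_comm L.length, ← add_assoc]
      exact hp₂
    · rw [he₂, he₁, heval, List.prod_cons, map_mul, mul_assoc]
    · rw [List.map_cons, List.prod_cons, ← mul_assoc]
      have n4 := ((n1.mono le_rfl (D' := (C₁ + C₂ + C) * N) ?_).trans (n2.mono le_rfl ?_)).mul_right
        (L.map (lit hP)).prod
      · refine (n4.trans (n3.mono le_rfl ?_)).mono ?_ le_rfl
        · exact Nat.mul_le_mul_right _ (by omega)
        · rw [add_mul, add_mul]
      · exact Nat.mul_le_mul_right _ (by omega)
      · exact Nat.mul_le_mul_right _ (by omega)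

omit hφ in
theorem exists_list_of_frame (γ : Frame G) (g : G) : ∃ L : List G,
    (∀ h ∈ L, h ∈ ({γ.x, γ.a, γ.b, γ.z, γ.u, γ.v} : Set G) ∨
      h⁻¹ ∈ ({γ.x, γ.a, γ.b, γ.z, γ.u, γ.v} : Set G)) ∧ L.prod = g := by
  have hg : g ∈ (Subgroup.closure {γ.x, γ.a, γ.b, γ.z, γ.u, γ.v}).toSubmonoid := by
    rw [γ.closure_eq]; trivial
  rw [Subgroup.closure_toSubmonoid] at hg
  exact Submonoid.exists_list_of_mem_closure hg

/-- Multiplying a normal form word by a fixed word in the generators of the presentation. -/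
theorem exists_nf_mul_word (y : FreeGroup (Fin k)) :
    ∃ C, ∀ N j p, j + C ≤ N → 1 ≤ N → NF.Inv N j p →
      ∃ p' : NF, p'.Inv N (j + C) ∧ p'.eval N = p.eval N * φ (FreeGroup.lift s y) ∧
        Near R (C * N ^ 2) (C * N) (nfWord hP γ N p * y) (nfWord hP γ N p') := by
  obtain ⟨L, hL, hLp⟩ := exists_list_of_frame γ (FreeGroup.lift s y)
  obtain ⟨C, hC⟩ := exists_nf_mul_list hP hφ L hL
  obtain ⟨B, hB⟩ := exists_near hP (g := y) (h := (L.map (lit hP)).prod) (by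
    rw [← hLp, map_list_prod, List.map_map]
    congr 1
    conv_lhs => rw [← List.map_id L]
    exact List.map_congr_left fun g _ => (lift_surjInv hP g).symm)
  obtain ⟨A, hA⟩ := exists_norm_nfWord_le hP γ 50
  refine ⟨A + B + C + L.length, fun N j p hj hN hp => ?_⟩
  obtain ⟨p', hp', he', n1⟩ := hC N j p (by omega) hN hp
  refine ⟨p', hp'.mono (by omega), by rw [he', hLp], ?_⟩
  have n2 := hB.mul_left (nfWord hP γ N p)
  have hN2 : 1 ≤ N ^ 2 := Nat.one_le_pow _ _ hN
  have h3 := hA N p hN (hp.bdd (by omega))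
  refine ((n2.mono le_rfl ?_).trans (n1.mono le_rfl ?_)).mono ?_ le_rfl
  · nlinarith
  · exact Nat.mul_le_mul_right _ (by omega)
  · nlinarith

omit hφ in
theorem NF.inv_zero (N : ℕ) : NF.Inv N 0 ⟨0, 0, 0, 0, 0, 0, 0, 0, 0⟩ := by
  constructor <;> simp

omit hφ in
theorem nfWord_zero (N : ℕ) : nfWord hP γ N ⟨0, 0, 0, 0, 0, 0, 0, 0, 0⟩ = 1 := by
  simp [nfWord]

/-- A word of length `ℓ` is brought into normal form of scale `N ≥ C ℓ` by `ℓ` steps of quadratic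
cost. -/
theorem exists_nf_of_word : ∃ C, ∀ N, 1 ≤ N → ∀ L : List (Fin k × Bool), C * L.length ≤ N →
    ∃ p : NF, p.Inv N (C * L.length) ∧ p.eval N = φ (FreeGroup.lift s (FreeGroup.mk L)) ∧
      Near R (L.length * (C * N ^ 2)) (C * N) (FreeGroup.mk L) (nfWord hP γ N p) := by
  choose C hC using fun y : Fin k × Bool => exists_nf_mul_word hP hφ (FreeGroup.mk [y])
  refine ⟨∑ y, C y, fun N hN L => ?_⟩
  induction L using List.reverseRecOn with
  | nil =>
    intro _
    refine ⟨⟨0, 0, 0, 0, 0, 0, 0, 0, 0⟩, by simpa using NF.inv_zero N, ?_, ?_⟩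
    · rw [← FreeGroup.one_eq_mk, map_one, map_one]
      ext <;> simp [NF.eval, Model.one_def]
    · rw [nfWord_zero, ← FreeGroup.one_eq_mk]
      exact Near.refl _
  | append_singleton L y ih =>
    intro hL
    have hCy : C y ≤ ∑ y, C y := Finset.single_le_sum (fun _ _ => Nat.zero_le _) (Finset.mem_univ y)
    rw [List.length_append, List.length_singleton, mul_add, mul_one] at hL
    obtain ⟨p, hp, he, n1⟩ := ih (by omega)
    obtain ⟨p', hp', he', n2⟩ := hC y N _ p (by omega) hN hp
    refine ⟨p', ?_, ?_, ?_⟩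
    · rw [List.length_append, List.length_singleton, mul_add, mul_one]
      exact hp'.mono (by omega)
    · rw [he', he, ← FreeGroup.mul_mk, map_mul, map_mul]
    · rw [← FreeGroup.mul_mk, List.length_append, List.length_singleton, add_mul, one_mul]
      exact (n1.mul_right _).trans (n2.mono (Nat.mul_le_mul_right _ hCy) (Nat.mul_le_mul_right _ hCy))

omit hφ in
/-- A normal form word with trivial value is filled at quadratic cost. -/
theorem exists_near_one_of_eval : ∃ C, ∀ N j p, 1 ≤ N → j ≤ N → NF.Inv N j p → p.eval N = 1 →
    Near R (C * N ^ 2) (C * N) (nfWord hP γ N p) 1 := by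
  obtain ⟨C₁, h₁⟩ := exists_near_carryQ hP γ
  obtain ⟨C₂, h₂⟩ := exists_near_carryZ hP γ
  refine ⟨C₁ + C₂, fun N j p hN hj hp he => ?_⟩
  have hb := hp.bdd hj
  obtain ⟨hi, hs, hc, hd, hk, hq, hl, hm, hr⟩ := hp
  have hNz : (1 : ℤ) ≤ N := by exact_mod_cast hN
  rw [Model.ext_iff] at he
  simp only [NF.eval, Model.one_def] at he
  obtain ⟨ei, es, et, ew, em, er⟩ := he
  rw [abs_le] at hk hq hl
  -- The bound `|k| ≤ N` excludes `2 N d + k = 0` unless `d = 0`, and then `|N q + l| ≤ N ² + N`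
  -- leaves `|c| ≤ 2` in the vanishing of the last coordinate.
  have hd0 : p.d = 0 := by
    by_contra h
    rcases lt_or_gt_of_ne h with h | h <;> nlinarith
  have hk0 : p.k = 0 := by simpa [hd0] using et
  rw [hk0] at ew
  have hc2 : |p.c| ≤ 2 := by
    rw [abs_le]
    constructor <;> by_contra h <;> push Not at h <;> nlinarith
  have n1 := h₁ N p hN hb (-p.c) (by rw [abs_neg]; linarith)
  set p₁ := NF.carryQ (-p.c) N p with hp₁
  have hq₁ : N * p₁.q + p.l = 0 := by
    simp only [hp₁, NF.carryQ]
    linarith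
  have hq1 : |p₁.q| ≤ 1 := by
    rw [abs_le]
    constructor <;> by_contra h <;> push Not at h <;> nlinarith
  have hb₁ : p₁.Bdd 50 N := ⟨hb.i, hb.s, by simp [hp₁, NF.carryQ], hb.d, hb.k,
    hq1.trans (by push_cast; linarith), hb.l, hb.m, hb.r⟩
  have n2 := h₂ N p₁ hN hb₁ (-p₁.q) (by rw [abs_neg]; linarith)
  have h0 : NF.carryZ (-p₁.q) N p₁ = ⟨0, 0, 0, 0, 0, 0, 0, 0, 0⟩ := by
    ext <;> simp only [NF.carryZ]
    exacts [ei, es, by simp [hp₁, NF.carryQ], hd0, hk0, by ring,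
      by linarith [show p₁.l = p.l from rfl], em, er]
  rw [h0, nfWord_zero] at n2
  refine ((n1.mono le_rfl ?_).trans (n2.mono le_rfl ?_)).mono ?_ le_rfl
  · exact Nat.mul_le_mul_right _ (by omega)
  · exact Nat.mul_le_mul_right _ (by omega)
  · rw [add_mul]

include hP in
/-- Null-homotopic words of length `n` have fillings of cubic area and linear diameter. -/
theorem exists_fillable_cubic : ∃ C, ∀ w : FreeGroup (Fin k), FreeGroup.lift s w = 1 →
    Fillable R (C * w.norm ^ 3) (C * w.norm) w := by
  obtain ⟨C, hC⟩ := exists_nf_of_word hP hφ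
  obtain ⟨B, hB⟩ := exists_near_one_of_eval hP (γ := γ)
  -- The scale is `(C + 1) ℓ` for a word of length `ℓ`.
  refine ⟨(B + C) * (C + 1) ^ 2, fun w hw => ?_⟩
  rcases Nat.eq_zero_or_pos w.norm with h0 | h0
  · rw [FreeGroup.norm_eq_zero.1 h0]
    exact Fillable.one _ _
  have hlen : w.toWord.length = w.norm := rfl
  have hN : 1 ≤ (C + 1) * w.norm := Nat.mul_pos (Nat.succ_pos _) h0
  have hle : C * w.norm ≤ (C + 1) * w.norm := Nat.mul_le_mul_right _ (Nat.le_succ _)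
  obtain ⟨p, hp, he, n1⟩ := hC _ hN w.toWord hle
  rw [FreeGroup.mk_toWord, hw, map_one] at he
  rw [FreeGroup.mk_toWord, hlen] at n1
  have n2 := hB _ _ p hN hle hp he
  have n3 := (n1.mono le_rfl (D' := (B + C) * ((C + 1) * w.norm)) ?_).trans (n2.mono le_rfl ?_)
  · unfold Near at n3
    rw [inv_one, mul_one] at n3
    refine n3.mono ?_ ?_
    · have h1 : w.norm ^ 2 ≤ w.norm ^ 3 := Nat.pow_le_pow_right h0 (by norm_num)
      calc _ = C * (C + 1) ^ 2 * w.norm ^ 3 + B * (C + 1) ^ 2 * w.norm ^ 2 := by ring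
        _ ≤ C * (C + 1) ^ 2 * w.norm ^ 3 + B * (C + 1) ^ 2 * w.norm ^ 3 := by gcongr
        _ = _ := by ring
    · calc _ = (B + C) * (C + 1) * w.norm := by ring
        _ ≤ (B + C) * (C + 1) ^ 2 * w.norm := by gcongr; nlinarith
  · exact Nat.mul_le_mul_right _ (by omega)
  · exact Nat.mul_le_mul_right _ (by omega)

end Reduction

/-! ### The cubic lower bound -/

namespace Model

theorem pow_x_add (α : ℤ) (n : ℕ) :
    (⟨1, 0, 0, α, 0, 0⟩ : Model) ^ n = ⟨n, 0, 0, n * α, 0, 0⟩ := by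
  induction n with
  | zero => ext <;> simp [one_def]
  | succ n ih => rw [pow_succ, ih]; ext <;> simp [mul_def]; ring

theorem pow_a_add (α : ℤ) (n : ℕ) :
    (⟨0, 1, 0, α, 0, 0⟩ : Model) ^ n = ⟨0, n, 0, n * α, 0, 0⟩ := by
  induction n with
  | zero => ext <;> simp [one_def]
  | succ n ih => rw [pow_succ, ih]; ext <;> simp [mul_def]; ring

/-- The central subgroup of elements of which only the coordinate `w` is nonzero. -/
def zSubgroup : Subgroup Model where
  carrier := {g | g.i = 0 ∧ g.s = 0 ∧ g.t = 0 ∧ g.m = 0 ∧ g.r = 0}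
  one_mem' := ⟨rfl, rfl, rfl, rfl, rfl⟩
  mul_mem' := by
    rintro g h ⟨h1, h2, h3, h4, h5⟩ ⟨h1', h2', h3', h4', h5'⟩
    simp [mul_def, *]
  inv_mem' := by
    rintro g ⟨h1, h2, h3, h4, h5⟩
    simp [inv_def, *]

theorem mem_zSubgroup {g : Model} :
    g ∈ zSubgroup ↔ g.i = 0 ∧ g.s = 0 ∧ g.t = 0 ∧ g.m = 0 ∧ g.r = 0 := Iff.rfl

theorem conj_eq_of_mem_zSubgroup {g : Model} (hg : g ∈ zSubgroup) (h : Model) :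
    h * g * h⁻¹ = g := by
  obtain ⟨h1, h2, h3, h4, h5⟩ := hg
  ext <;> simp [mul_def, inv_def, *] <;> ring

instance : zSubgroup.Normal where
  conj_mem g hg h := by rwa [conj_eq_of_mem_zSubgroup hg]

theorem w_mul_of_mem_zSubgroup (g : Model) {h : Model} (hh : h ∈ zSubgroup) :
    (g * h).w = g.w + h.w := by
  obtain ⟨h1, h2, h3, h4, h5⟩ := hh
  simp [mul_def, *]

theorem w_inv_of_mem_zSubgroup {h : Model} (hh : h ∈ zSubgroup) : h⁻¹.w = -h.w := by
  obtain ⟨h1, h2, h3, h4, h5⟩ := hh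
  simp [inv_def, *]

end Model

namespace Frame

variable {G : Type*} [Group G] (γ : Frame G)

theorem exists_conj_pow_x (n : ℕ) : ∃ k l : ℕ,
    γ.a * γ.x ^ n = γ.x ^ n * (γ.a * γ.b ^ k * γ.z ^ l) := by
  induction n with
  | zero => exact ⟨0, 0, by simp⟩
  | succ n ih =>
    obtain ⟨k, l, h⟩ := ih
    have hb : γ.b ^ k * γ.x = γ.x * (γ.b ^ k * γ.z ^ k) := by
      rw [← γ.b_z.mul_pow]
      exact SemiconjBy.pow_right (a := γ.x) (x := γ.b * γ.z) (y := γ.b)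
        (by rw [SemiconjBy, γ.b_x, mul_assoc]) k |>.eq.symm
    refine ⟨k + 1, k + l, ?_⟩
    calc γ.a * γ.x ^ (n + 1) = γ.x ^ n * (γ.a * γ.b ^ k * (γ.z ^ l * γ.x)) := by
          rw [pow_succ, ← mul_assoc, h]; simp only [mul_assoc]
      _ = γ.x ^ n * (γ.a * (γ.b ^ k * γ.x) * γ.z ^ l) := by
          rw [(γ.x_z.pow_right l).symm.eq]; simp only [mul_assoc]
      _ = γ.x ^ n * ((γ.a * γ.x) * γ.b ^ k * γ.z ^ k * γ.z ^ l) := by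
          rw [hb]; simp only [mul_assoc]
      _ = _ := by rw [γ.a_x, pow_succ, pow_succ', pow_add]; simp only [mul_assoc]

theorem commute_conj_pow (n : ℕ) : Commute (γ.a ^ n) ((γ.x ^ n)⁻¹ * γ.a ^ n * γ.x ^ n) := by
  obtain ⟨k, l, h⟩ := γ.exists_conj_pow_x n
  have h1 : (γ.x ^ n)⁻¹ * γ.a ^ n * γ.x ^ n = (γ.a * γ.b ^ k * γ.z ^ l) ^ n := by
    have := conj_pow (i := n) (a := (γ.x ^ n)⁻¹) (b := γ.a)
    rw [inv_inv] at this
    rw [← this, mul_assoc, h, inv_mul_cancel_left]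
  rw [h1]
  exact (((Commute.refl _).mul_right (γ.a_b.pow_right k)).mul_right
    (γ.a_z.pow_right l)).pow_pow n n

end Frame

section LowerBound

variable {k : ℕ} {R : Set (FreeGroup (Fin k))} {G : Type*} [Group G] {s : Fin k → G}

theorem lift_lit (hP : IsFinitePresentation s R) (g : G) : FreeGroup.lift s (lit hP g) = g :=
  lift_surjInv hP g

/-- The commutator of `a ^ n` and its conjugate by `x ^ n`. -/
def testWord (a x : FreeGroup (Fin k)) (n : ℕ) : FreeGroup (Fin k) :=
  a ^ n * ((x ^ n)⁻¹ * a ^ n * x ^ n) * (a ^ n)⁻¹ * ((x ^ n)⁻¹ * a ^ n * x ^ n)⁻¹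

theorem norm_testWord_le (a x : FreeGroup (Fin k)) (n : ℕ) :
    (testWord a x n).norm ≤ (4 * (a.norm + x.norm)) * n := by
  have ha := norm_pow_le a n
  have hx := norm_pow_le x n
  have h1 : ((x ^ n)⁻¹ * a ^ n * x ^ n).norm ≤ n * x.norm + n * a.norm + n * x.norm := by
    refine (FreeGroup.norm_mul_le _ _).trans (add_le_add ((FreeGroup.norm_mul_le _ _).trans
      (add_le_add ?_ ha)) hx)
    rwa [FreeGroup.norm_inv_eq]
  unfold testWord
  refine (FreeGroup.norm_mul_le _ _).trans (le_trans (add_le_add ((FreeGroup.norm_mul_le _ _).trans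
    (add_le_add ((FreeGroup.norm_mul_le _ _).trans (add_le_add ha h1)) ?_)) ?_)
    (b := n * a.norm + (n * x.norm + n * a.norm + n * x.norm) + n * a.norm +
      (n * x.norm + n * a.norm + n * x.norm)) ?_)
  · rwa [FreeGroup.norm_inv_eq]
  · rwa [FreeGroup.norm_inv_eq]
  · nlinarith

/-- In a lift of the presentation to a central extension, the central coordinate of a
null-homotopic word is at most linear in the area. -/
theorem w_le_of_isFilling (ψ : FreeGroup (Fin k) →* Model) {M : ℕ}
    (hR : ∀ r ∈ R, ψ r ∈ Model.zSubgroup ∧ (ψ r).w.natAbs ≤ M)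
    (F : List (FreeGroup (Fin k) × FreeGroup (Fin k))) (hF : ∀ c ∈ F, c.2 ∈ R ∨ c.2⁻¹ ∈ R) :
    ψ (F.map fun c => c.1⁻¹ * c.2 * c.1).prod ∈ Model.zSubgroup ∧
      (ψ (F.map fun c => c.1⁻¹ * c.2 * c.1).prod).w.natAbs ≤ M * F.length := by
  induction F with
  | nil => simp [Model.one_def, Model.mem_zSubgroup]
  | cons c F ih =>
    obtain ⟨ih1, ih2⟩ := ih fun d hd => hF d (List.mem_cons_of_mem _ hd)
    have hc : ψ c.2 ∈ Model.zSubgroup ∧ (ψ c.2).w.natAbs ≤ M := by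
      rcases hF c List.mem_cons_self with h | h
      · exact hR _ h
      · obtain ⟨h1, h2⟩ := hR _ h
        rw [map_inv] at h1 h2
        have h3 := inv_mem_iff.1 h1
        rw [Model.w_inv_of_mem_zSubgroup h3, Int.natAbs_neg] at h2
        exact ⟨h3, h2⟩
    have he : ψ (c.1⁻¹ * c.2 * c.1) = ψ c.2 := by
      have := Model.conj_eq_of_mem_zSubgroup hc.1 (ψ c.1)⁻¹
      rw [inv_inv] at this
      rw [map_mul, map_mul, map_inv, this]
    rw [List.map_cons, List.prod_cons, map_mul, he, List.length_cons, mul_add, mul_one]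
    refine ⟨mul_mem hc.1 ih1, ?_⟩
    rw [Model.w_mul_of_mem_zSubgroup _ ih1]
    exact (Int.natAbs_add_le _ _).trans (by omega)

/-- If exchanging `a` and `x` defines a homomorphism to the model modulo its central subgroup, the
Dehn function is at least cubic: in the model, the conjugate of `x ^ n` by `a ^ n` does not commute
with `x ^ n`, and their commutator is central of size `2 n ³`. -/
theorem cubic_asympLE_dehn (hP : IsFinitePresentation s R) (γ : Frame G)
    (ρ : G →* Model ⧸ Model.zSubgroup) (ha : ρ γ.a = (Model.x : Model))
    (hx : ρ γ.x = (Model.a : Model)) :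
    AsympLE (fun n => ((n ^ 3 : ℕ) : ℕ∞)) (dehn R) := by
  obtain ⟨ψ, hψ⟩ : ∃ ψ : FreeGroup (Fin k) →* Model,
      ∀ w, ((ψ w : Model) : Model ⧸ Model.zSubgroup) = ρ (FreeGroup.lift s w) := by
    refine ⟨FreeGroup.lift fun i => (ρ (s i)).out, fun w => ?_⟩
    have : (QuotientGroup.mk' Model.zSubgroup).comp (FreeGroup.lift fun i => (ρ (s i)).out) =
        ρ.comp (FreeGroup.lift s) := by
      ext i
      simp
    exact DFunLike.congr_fun this w
  -- The map `ψ` need not kill the relators, but it sends null-homotopic words to central elements.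
  have hmem : ∀ w, FreeGroup.lift s w = 1 → ψ w ∈ Model.zSubgroup := fun w hw => by
    rw [← QuotientGroup.eq_one_iff, hψ, hw, map_one]
  have hRel : ∀ r ∈ R, FreeGroup.lift s r = 1 := fun r hr => by
    rw [← MonoidHom.mem_ker, hP.ker_eq]
    exact Subgroup.subset_normalClosure hr
  obtain ⟨M, hM⟩ : ∃ M, ∀ r ∈ R, (ψ r).w.natAbs ≤ M := by
    obtain ⟨M, hM⟩ := (hP.finite.image fun r => (ψ r).w.natAbs).bddAbove
    exact ⟨M, fun r hr => hM ⟨r, hr, rfl⟩⟩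
  obtain ⟨α, hα⟩ : ∃ α, ψ (lit hP γ.a) = ⟨1, 0, 0, α, 0, 0⟩ := by
    have h := hψ (lit hP γ.a)
    rw [lift_lit, ha, eq_comm, QuotientGroup.eq, Model.mem_zSubgroup] at h
    refine ⟨(ψ (lit hP γ.a)).w, ?_⟩
    simp only [Model.mul_def, Model.inv_def, Model.x] at h
    obtain ⟨h1, h2, h3, h4, h5⟩ := h
    ext <;> linarith
  obtain ⟨β, hβ⟩ : ∃ β, ψ (lit hP γ.x) = ⟨0, 1, 0, β, 0, 0⟩ := by
    have h := hψ (lit hP γ.x)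
    rw [lift_lit, hx, eq_comm, QuotientGroup.eq, Model.mem_zSubgroup] at h
    refine ⟨(ψ (lit hP γ.x)).w, ?_⟩
    simp only [Model.mul_def, Model.inv_def, Model.a] at h
    obtain ⟨h1, h2, h3, h4, h5⟩ := h
    have h1' : (ψ (lit hP γ.x)).i = 0 := by simpa using h1
    simp only [h1'] at h3
    ext <;> linarith
  set A := M + 1 + 4 * ((lit hP γ.a).norm + (lit hP γ.x).norm) with hA
  refine ⟨A, fun n => ?_⟩
  set w := testWord (lit hP γ.a) (lit hP γ.x) n with hw
  have hw1 : FreeGroup.lift s w = 1 := by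
    simp only [hw, testWord, map_mul, map_inv, map_pow, lift_lit]
    rw [(γ.commute_conj_pow n).eq]
    group
  have hw2 : (ψ w).w.natAbs = 2 * n ^ 3 := by
    have : (ψ w).w = (2 * n ^ 3 : ℕ) := by
      simp only [hw, testWord, map_mul, map_inv, map_pow, hα, hβ, Model.pow_x_add,
        Model.pow_a_add, Model.mul_def, Model.inv_def]
      push_cast
      ring
    omega
  have harea : ((n ^ 3 / (M + 1) : ℕ) : ℕ∞) ≤ area R w := by
    refine le_iInf₂ fun F hF => ?_
    obtain ⟨h1, h2⟩ := hF
    have h3 := (w_le_of_isFilling ψ (fun r hr => ⟨hmem r (hRel r hr), hM r hr⟩) F h1).2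
    rw [← h2, hw2] at h3
    exact_mod_cast Nat.div_le_of_le_mul (by nlinarith)
  have hdehn : area R w ≤ dehn R (A * n + A) := by
    refine le_iSup₂_of_le w ⟨?_, ?_⟩ le_rfl
    · rw [← hP.ker_eq]; exact hw1
    · refine (norm_testWord_le _ _ _).trans ?_
      have : 4 * ((lit hP γ.a).norm + (lit hP γ.x).norm) ≤ A := by omega
      nlinarith
  have hn : n ^ 3 ≤ A * (n ^ 3 / (M + 1)) + A := by
    have h1 := Nat.lt_mul_div_succ (n ^ 3) (Nat.succ_pos M)
    have h2 : M + 1 ≤ A := by omega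
    have h3 : (M + 1) * (n ^ 3 / (M + 1) + 1) ≤ A * (n ^ 3 / (M + 1) + 1) :=
      Nat.mul_le_mul_right _ h2
    simp only [Nat.succ_eq_add_one] at h1
    linarith
  calc ((n ^ 3 : ℕ) : ℕ∞) ≤ ((A * (n ^ 3 / (M + 1)) + A : ℕ) : ℕ∞) := by exact_mod_cast hn
    _ = (A : ℕ∞) * ((n ^ 3 / (M + 1) : ℕ) : ℕ∞) + A := by push_cast; rfl
    _ ≤ _ := by gcongr; exact harea.trans hdehn

end LowerBound

/-! ### The group `Γ_{4,3}` -/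

section Filiform

variable {p : ℕ}

theorem Filiform.mul_of {a j l : Fin p} (ha : a.val = 0) (hj : 1 ≤ j.val) (hl : l.val = j.val + 1) :
    (PresentedGroup.of a : Filiform p) * PresentedGroup.of j =
      PresentedGroup.of j * PresentedGroup.of a * PresentedGroup.of l := by
  have h : PresentedGroup.mk (filiformRels p)
      (groupComm (FreeGroup.of a) (FreeGroup.of j) * (FreeGroup.of l)⁻¹) = 1 :=
    PresentedGroup.one_of_mem (Or.inl (Or.inl ⟨a, j, l, ha, hj, hl, rfl⟩))
  simp only [groupComm, map_mul, map_inv] at h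
  change (PresentedGroup.of a)⁻¹ * (PresentedGroup.of j)⁻¹ * PresentedGroup.of a *
    PresentedGroup.of j * (PresentedGroup.of l)⁻¹ = 1 at h
  rw [mul_inv_eq_one] at h
  rw [← h]
  group

theorem commute_of_groupComm_eq_one {G : Type*} [Group G] {g h : G} (hgh : groupComm g h = 1) :
    Commute g h := by
  unfold groupComm at hgh
  change g * h = h * g
  calc g * h = h * g * (g⁻¹ * h⁻¹ * g * h) := by group
    _ = _ := by rw [hgh, mul_one]

theorem groupComm_eq_one_of_commute {G : Type*} [Group G] {g h : G} (hgh : Commute g h) :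
    groupComm g h = 1 := by
  unfold groupComm
  rw [mul_assoc, hgh.eq]; group

theorem Filiform.commute_of {i j : Fin p} (hi : 1 ≤ i.val) (hj : 1 ≤ j.val) :
    Commute (PresentedGroup.of i : Filiform p) (PresentedGroup.of j) :=
  commute_of_groupComm_eq_one
    (PresentedGroup.one_of_mem (rels := filiformRels p) (Or.inl (Or.inr ⟨i, j, hi, hj, rfl⟩)))

theorem Filiform.commute_last {a l : Fin p} (ha : a.val = 0) (hl : l.val + 1 = p) :
    Commute (PresentedGroup.of a : Filiform p) (PresentedGroup.of l) :=
  commute_of_groupComm_eq_one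
    (PresentedGroup.one_of_mem (rels := filiformRels p) (Or.inr ⟨a, l, ha, hl, rfl⟩))

theorem lift_filiformRels {G : Type*} [Group G] {f : Fin p → G}
    (h1 : ∀ a j l : Fin p, a.val = 0 → 1 ≤ j.val → l.val = j.val + 1 →
      groupComm (f a) (f j) = f l)
    (h2 : ∀ i j : Fin p, 1 ≤ i.val → 1 ≤ j.val → groupComm (f i) (f j) = 1)
    (h3 : ∀ a l : Fin p, a.val = 0 → l.val + 1 = p → groupComm (f a) (f l) = 1) :
    ∀ r ∈ filiformRels p, FreeGroup.lift f r = 1 := by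
  have hc : ∀ g h, FreeGroup.lift f (groupComm g h) =
      groupComm (FreeGroup.lift f g) (FreeGroup.lift f h) := fun g h => by simp [groupComm]
  rintro r ((⟨a, j, l, ha, hj, hl, rfl⟩ | ⟨i, j, hi, hj, rfl⟩) | ⟨a, l, ha, hl, rfl⟩)
  · rw [map_mul, hc, map_inv, FreeGroup.lift_apply_of, FreeGroup.lift_apply_of,
      FreeGroup.lift_apply_of, h1 a j l ha hj hl, mul_inv_cancel]
  · rw [hc, FreeGroup.lift_apply_of, FreeGroup.lift_apply_of, h2 i j hi hj]
  · rw [hc, FreeGroup.lift_apply_of, FreeGroup.lift_apply_of, h3 a l ha hl]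

theorem finite_filiformRels (p : ℕ) : (filiformRels p).Finite := by
  refine ((Set.Finite.subset (Set.finite_range fun t : Fin p × Fin p × Fin p =>
    groupComm (FreeGroup.of t.1) (FreeGroup.of t.2.1) * (FreeGroup.of t.2.2)⁻¹) ?_).union
    (Set.Finite.subset (Set.finite_range fun t : Fin p × Fin p =>
    groupComm (FreeGroup.of t.1) (FreeGroup.of t.2)) ?_)).union
    (Set.Finite.subset (Set.finite_range fun t : Fin p × Fin p =>
    groupComm (FreeGroup.of t.1) (FreeGroup.of t.2)) ?_)
  · rintro r ⟨a, j, l, -, -, -, rfl⟩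
    exact ⟨(a, j, l), rfl⟩
  · rintro r ⟨i, j, -, -, rfl⟩
    exact ⟨(i, j), rfl⟩
  · rintro r ⟨a, l, -, -, rfl⟩
    exact ⟨(a, l), rfl⟩

end Filiform

theorem commute_of_commute_of {α β G : Type*} [Group G] {S : Set (FreeGroup α)}
    {T : Set (FreeGroup β)} (f : PresentedGroup S →* G) (g : PresentedGroup T →* G)
    (h : ∀ i j, Commute (f (.of i)) (g (.of j))) (x : PresentedGroup S) (y : PresentedGroup T) :
    Commute (f x) (g y) := by
  have h1 : ∀ i, ∀ y, Commute (f (.of i)) (g y) := fun i y =>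
    Subgroup.mem_centralizer_singleton_iff.1 (PresentedGroup.generated_by T
      ((Subgroup.centralizer {f (.of i)}).comap g)
      (fun j => Subgroup.mem_comap.2
        (Subgroup.mem_centralizer_singleton_iff.2 (h i j).symm.eq)) y) |> Eq.symm
  exact Subgroup.mem_centralizer_singleton_iff.1 (PresentedGroup.generated_by S
      ((Subgroup.centralizer {g y}).comap f)
      (fun i => Subgroup.mem_comap.2 (Subgroup.mem_centralizer_singleton_iff.2 (h1 i y).eq)) x)

namespace Gamma

/-- The image in `Γ_{4,3}` of the generator `x_{i+1}` of `Λ_4`. -/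
def gen₄ (i : Fin 4) : Gamma 4 3 :=
  QuotientGroup.mk ((PresentedGroup.of i : Filiform 4), (1 : Filiform 3))

/-- The image in `Γ_{4,3}` of the generator `x_{j+1}` of `Λ_3`. -/
def gen₃ (j : Fin 3) : Gamma 4 3 :=
  QuotientGroup.mk ((1 : Filiform 4), (PresentedGroup.of j : Filiform 3))

theorem gen₄_three : gen₄ 3 = gen₃ 2 := by
  refine (QuotientGroup.eq_iff_div_mem).2 (Subgroup.subset_normalClosure ?_)
  simp only [Set.mem_singleton_iff, div_eq_mul_inv, Prod.inv_mk, Prod.mk_mul_mk, inv_one, mul_one,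
    one_mul]
  rfl

theorem exists_hom {H : Type*} [Group H] (f : Filiform 4 →* H) (g : Filiform 3 →* H)
    (hc : ∀ i j, Commute (f (.of i)) (g (.of j))) (hz : f (.of 3) = g (.of 2)) :
    ∃ φ : Gamma 4 3 →* H, (∀ x y, φ (QuotientGroup.mk (x, y)) = f x * g y) := by
  refine ⟨QuotientGroup.lift _ (MonoidHom.noncommCoprod f g (commute_of_commute_of f g hc)) ?_,
    fun x y => rfl⟩
  have : Subgroup.normalClosure ({(filiformZ 4, (filiformZ 3)⁻¹)} : Set (Filiform 4 × Filiform 3)) ≤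
      (MonoidHom.noncommCoprod f g (commute_of_commute_of f g hc)).ker := by
    refine Subgroup.normalClosure_le_normal ?_
    rw [Set.singleton_subset_iff]
    change f (.of 3) * g (.of 2)⁻¹ = 1
    rw [hz, map_inv, mul_inv_cancel]
  exact this

theorem eq_top_of_gen_mem (K : Subgroup (Gamma 4 3)) (h4 : ∀ i, gen₄ i ∈ K) (h3 : ∀ j, gen₃ j ∈ K) :
    K = ⊤ := by
  refine eq_top_iff.2 fun w _ => ?_
  obtain ⟨⟨x, y⟩, rfl⟩ := QuotientGroup.mk_surjective w
  have hx := PresentedGroup.generated_by _ (K.comap ((QuotientGroup.mk' _).comp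
    (MonoidHom.inl (Filiform 4) (Filiform 3)))) h4 x
  have hy := PresentedGroup.generated_by _ (K.comap ((QuotientGroup.mk' _).comp
    (MonoidHom.inr (Filiform 4) (Filiform 3)))) h3 y
  have := mul_mem (Subgroup.mem_comap.1 hx) (Subgroup.mem_comap.1 hy)
  have e : (QuotientGroup.mk (x, y) : Gamma 4 3) =
      QuotientGroup.mk (x, 1) * QuotientGroup.mk (1, y) := by
    rw [← QuotientGroup.mk_mul, Prod.mk_mul_mk, mul_one, one_mul]
  rw [e]
  exact this

theorem commute_gen₄_gen₃ (i : Fin 4) (j : Fin 3) : Commute (gen₄ i) (gen₃ j) :=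
  (MonoidHom.commute_inl_inr (PresentedGroup.of i : Filiform 4)
    (PresentedGroup.of j : Filiform 3)).map
    (QuotientGroup.mk' _)

/-- The homomorphism `Λ_4 → Γ_{4,3}`. -/
def ofFour : Filiform 4 →* Gamma 4 3 := (QuotientGroup.mk' _).comp (MonoidHom.inl _ _)

/-- The homomorphism `Λ_3 → Γ_{4,3}`. -/
def ofThree : Filiform 3 →* Gamma 4 3 := (QuotientGroup.mk' _).comp (MonoidHom.inr _ _)

theorem mul_gen₄ {j l : Fin 4} (hj : 1 ≤ j.val) (hl : l.val = j.val + 1) :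
    gen₄ 0 * gen₄ j = gen₄ j * gen₄ 0 * gen₄ l :=
  congrArg ofFour (Filiform.mul_of (a := 0) rfl hj hl)

theorem mul_gen₃ : gen₃ 0 * gen₃ 1 = gen₃ 1 * gen₃ 0 * gen₃ 2 :=
  congrArg ofThree (Filiform.mul_of (a := 0) (j := 1) (l := 2) rfl le_rfl rfl)

theorem commute_gen₄ {i j : Fin 4} (hi : 1 ≤ i.val) (hj : 1 ≤ j.val) :
    Commute (gen₄ i) (gen₄ j) := (Filiform.commute_of hi hj).map ofFour

theorem commute_gen₄_last : Commute (gen₄ 0) (gen₄ 3) :=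
  (Filiform.commute_last rfl rfl).map ofFour

theorem commute_gen₃_last : Commute (gen₃ 0) (gen₃ 2) :=
  (Filiform.commute_last rfl rfl).map ofThree

theorem mul_inv_eq_of_mul_eq {G : Type*} [Group G] {a c d : G} (h : a * c = c * a * d)
    (hd : Commute a d) : c * a⁻¹ = a⁻¹ * c * d := by
  calc c * a⁻¹ = a⁻¹ * (a * c) * a⁻¹ := by group
    _ = a⁻¹ * c * (a * d) * a⁻¹ := by rw [h]; group
    _ = _ := by rw [hd.eq]; group

/-- The frame of `Γ_{4,3}`. The element `b` is forced by `a ^ x = a b`: conjugating `x_2` by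
`x = x_1⁻¹` gives `x_2 x_3 x_4`. -/
def frame : Frame (Gamma 4 3) where
  x := (gen₄ 0)⁻¹
  a := gen₄ 1
  b := gen₄ 2 * gen₄ 3
  z := gen₄ 3
  u := (gen₃ 0)⁻¹
  v := gen₃ 1
  a_x := by
    have h1 := mul_gen₄ (j := 1) (l := 2) le_rfl rfl
    have h2 := mul_gen₄ (j := 2) (l := 3) (by decide) rfl
    calc gen₄ 1 * (gen₄ 0)⁻¹ = (gen₄ 0)⁻¹ * (gen₄ 0 * gen₄ 1) * (gen₄ 0)⁻¹ := by group
      _ = (gen₄ 0)⁻¹ * gen₄ 1 * (gen₄ 0 * gen₄ 2) * (gen₄ 0)⁻¹ := by rw [h1]; group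
      _ = (gen₄ 0)⁻¹ * gen₄ 1 * gen₄ 2 * (gen₄ 0 * gen₄ 3) * (gen₄ 0)⁻¹ := by rw [h2]; group
      _ = _ := by rw [commute_gen₄_last.eq]; group
  b_x := by
    have h2 := mul_inv_eq_of_mul_eq (mul_gen₄ (j := 2) (l := 3) (by decide) rfl) commute_gen₄_last
    rw [mul_assoc, ← commute_gen₄_last.inv_left.eq, ← mul_assoc, h2]
    simp only [mul_assoc]
  v_u := by
    rw [gen₄_three]
    exact mul_inv_eq_of_mul_eq mul_gen₃ commute_gen₃_last
  a_b := (commute_gen₄ (by decide) (by decide)).mul_right (commute_gen₄ (by decide) (by decide))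
  a_z := commute_gen₄ (by decide) (by decide)
  a_u := (commute_gen₄_gen₃ _ _).inv_right
  a_v := commute_gen₄_gen₃ _ _
  b_z := (commute_gen₄ (by decide) (by decide)).mul_left (commute_gen₄ (by decide) (by decide))
  b_u := ((commute_gen₄_gen₃ _ _).mul_left (commute_gen₄_gen₃ _ _)).inv_right
  b_v := (commute_gen₄_gen₃ _ _).mul_left (commute_gen₄_gen₃ _ _)
  x_z := commute_gen₄_last.inv_left
  x_u := (commute_gen₄_gen₃ _ _).inv_inv
  x_v := (commute_gen₄_gen₃ _ _).inv_left
  u_z := (commute_gen₄_gen₃ _ _).symm.inv_left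
  v_z := (commute_gen₄_gen₃ _ _).symm
  closure_eq := by
    have hs := @Subgroup.subset_closure _ _ ({(gen₄ 0)⁻¹, gen₄ 1, gen₄ 2 * gen₄ 3, gen₄ 3,
      (gen₃ 0)⁻¹, gen₃ 1} : Set (Gamma 4 3))
    have h0 := inv_mem_iff.1 (hs (by simp : (gen₄ 0)⁻¹ ∈ _))
    have h1 := hs (by simp : gen₄ 1 ∈ _)
    have h2 := hs (by simp : gen₄ 2 * gen₄ 3 ∈ _)
    have h3 := hs (by simp : gen₄ 3 ∈ _)
    have h4 := inv_mem_iff.1 (hs (by simp : (gen₃ 0)⁻¹ ∈ _))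
    have h5 := hs (by simp : gen₃ 1 ∈ _)
    apply eq_top_of_gen_mem
    · intro i
      fin_cases i
      exacts [h0, h1, (Subgroup.mul_mem_cancel_right _ h3).1 h2, h3]
    · intro j
      fin_cases j
      exacts [h4, h5, gen₄_three ▸ h3]

/-- Only the relators of `Γ_{4,3}` have to be checked in the model, in the original generators. -/
theorem exists_modelHom : ∃ φ : Gamma 4 3 →* Model, frame.IsModelHom φ := by
  let f : Filiform 4 →* Model := PresentedGroup.toGroup
    (f := ![Model.x⁻¹, Model.a, Model.b * Model.z⁻¹, Model.z]) (lift_filiformRels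
      (by
        intro a j l ha hj hl
        fin_cases a <;> fin_cases j <;> fin_cases l <;> simp at ha hj hl <;>
          simp [groupComm, Model.mul_def, Model.inv_def, Model.x, Model.a, Model.b, Model.z])
      (by
        intro i j hi hj
        fin_cases i <;> fin_cases j <;> simp at hi hj <;>
          simp [groupComm, Model.mul_def, Model.inv_def, Model.one_def, Model.x, Model.a, Model.b,
            Model.z])
      (by
        intro a l ha hl
        fin_cases a <;> fin_cases l <;> simp at ha hl <;>
          simp [groupComm, Model.mul_def, Model.inv_def, Model.one_def, Model.x, Model.z]))
  let g : Filiform 3 →* Model := PresentedGroup.toGroup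
    (f := ![Model.u⁻¹, Model.v, Model.z]) (lift_filiformRels
      (by
        intro a j l ha hj hl
        fin_cases a <;> fin_cases j <;> fin_cases l <;> simp at ha hj hl <;>
          simp [groupComm, Model.mul_def, Model.inv_def, Model.u, Model.v, Model.z])
      (by
        intro i j hi hj
        fin_cases i <;> fin_cases j <;> simp at hi hj <;>
          simp [groupComm, Model.mul_def, Model.inv_def, Model.one_def, Model.v, Model.z])
      (by
        intro a l ha hl
        fin_cases a <;> fin_cases l <;> simp at ha hl <;>
          simp [groupComm, Model.mul_def, Model.inv_def, Model.one_def, Model.u, Model.z]))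
  have hf : ∀ i, f (.of i) = ![Model.x⁻¹, Model.a, Model.b * Model.z⁻¹, Model.z] i :=
    fun i => PresentedGroup.toGroup.of _
  have hg : ∀ j, g (.of j) = ![Model.u⁻¹, Model.v, Model.z] j :=
    fun i => PresentedGroup.toGroup.of _
  obtain ⟨φ, hφ⟩ := exists_hom f g (by
    intro i j
    rw [hf, hg]
    refine commute_of_groupComm_eq_one ?_
    fin_cases i <;> fin_cases j <;> simp [groupComm, Model.mul_def, Model.inv_def, Model.one_def,
      Model.x, Model.a, Model.b, Model.z, Model.u, Model.v]) (by rw [hf, hg]; rfl)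
  have h4 : ∀ i, φ (gen₄ i) = ![Model.x⁻¹, Model.a, Model.b * Model.z⁻¹, Model.z] i := fun i => by
    rw [← hf, gen₄, hφ, map_one, mul_one]
  have h3 : ∀ j, φ (gen₃ j) = ![Model.u⁻¹, Model.v, Model.z] j := fun j => by
    rw [← hg, gen₃, hφ, map_one, one_mul]
  refine ⟨φ, ?_, ?_, ?_, ?_, ?_, ?_⟩ <;> simp [frame, h4, h3]

/-- Modulo its central subgroup, the model contains the Heisenberg group generated by `x` and `a`,
to which the group maps with `a` and `x` exchanged; `z, u, v` go to `1`. -/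
theorem exists_swapHom : ∃ ρ : Gamma 4 3 →* Model ⧸ Model.zSubgroup,
    ρ frame.a = (Model.x : Model) ∧ ρ frame.x = (Model.a : Model) := by
  let c : Fin 4 → Model := ![Model.a⁻¹, Model.x, groupComm Model.a⁻¹ Model.x, 1]
  have hc : ∀ i j, groupComm ((c i : Model) : Model ⧸ Model.zSubgroup) (c j : Model) =
      ((groupComm (c i) (c j) : Model) : Model ⧸ Model.zSubgroup) := fun i j => rfl
  let f : Filiform 4 →* Model ⧸ Model.zSubgroup := PresentedGroup.toGroup
    (f := fun i => (c i : Model ⧸ Model.zSubgroup)) (lift_filiformRels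
      (by
        intro a j l ha hj hl
        rw [hc, QuotientGroup.eq, Model.mem_zSubgroup]
        fin_cases a <;> fin_cases j <;> fin_cases l <;> simp at ha hj hl <;>
          simp [c, groupComm, Model.mul_def, Model.inv_def, Model.one_def, Model.x, Model.a])
      (by
        intro i j hi hj
        rw [hc, QuotientGroup.eq_one_iff, Model.mem_zSubgroup]
        fin_cases i <;> fin_cases j <;> simp at hi hj <;>
          simp [c, groupComm, Model.mul_def, Model.inv_def, Model.one_def, Model.x, Model.a])
      (by
        intro a l ha hl
        rw [hc, QuotientGroup.eq_one_iff, Model.mem_zSubgroup]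
        fin_cases a <;> fin_cases l <;> simp at ha hl <;>
          simp [c, groupComm, Model.mul_def, Model.inv_def, Model.one_def, Model.a]))
  have hf : ∀ i, f (.of i) = (c i : Model ⧸ Model.zSubgroup) := fun i => PresentedGroup.toGroup.of _
  obtain ⟨φ, hφ⟩ := exists_hom f 1 (fun i j => Commute.one_right _) (by rw [hf]; rfl)
  have h4 : ∀ i, φ (gen₄ i) = (c i : Model ⧸ Model.zSubgroup) := fun i => by
    rw [← hf, gen₄, hφ, map_one, mul_one]
  refine ⟨φ, by rw [frame, h4]; rfl, ?_⟩
  change φ (gen₄ 0)⁻¹ = _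
  rw [map_inv, h4, ← QuotientGroup.mk_inv]
  simp [c]

/-- The group is the quotient of the free product of `Λ_4` and `Λ_3` by finitely many relators. -/
theorem isFinitelyPresented : Group.IsFinitelyPresented (Gamma 4 3) := by
  have h4 : Group.IsFinitelyPresented (Filiform 4) :=
    Group.IsFinitelyPresented.quotient _ ⟨_, finite_filiformRels 4, rfl⟩
  have h3 : Group.IsFinitelyPresented (Filiform 3) :=
    Group.IsFinitelyPresented.quotient _ ⟨_, finite_filiformRels 3, rfl⟩
  let q : Monoid.Coprod (Filiform 4) (Filiform 3) →* Gamma 4 3 := Monoid.Coprod.lift ofFour ofThree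
  have hq : Function.Surjective q := by
    rw [← MonoidHom.range_eq_top]
    exact eq_top_of_gen_mem _
      (fun i => ⟨Monoid.Coprod.inl (.of i), Monoid.Coprod.lift_apply_inl _ _ _⟩)
      (fun j => ⟨Monoid.Coprod.inr (.of j), Monoid.Coprod.lift_apply_inr _ _ _⟩)
  let T : Set (Monoid.Coprod (Filiform 4) (Filiform 3)) :=
    insert (Monoid.Coprod.inl (.of 3) * (Monoid.Coprod.inr (.of 2))⁻¹)
      (Set.range fun t : Fin 4 × Fin 3 =>
        groupComm (Monoid.Coprod.inl (.of t.1)) (Monoid.Coprod.inr (.of t.2)))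
  have hT : T.Finite := (Set.finite_range _).insert _
  refine Group.IsFinitelyPresented.of_surjective q hq ⟨T, hT, le_antisymm ?_ ?_⟩
  · refine Subgroup.normalClosure_le_normal ?_
    rintro t (rfl | ⟨⟨i, j⟩, rfl⟩)
    · change q _ = 1
      rw [map_mul, map_inv, mul_inv_eq_one]
      exact gen₄_three
    · change q _ = 1
      simp only [groupComm, map_mul, map_inv]
      exact groupComm_eq_one_of_commute (commute_gen₄_gen₃ i j)
  · let π := QuotientGroup.mk' (Subgroup.normalClosure T)
    have hπ : ∀ t ∈ T, π t = 1 := fun t ht =>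
      (QuotientGroup.eq_one_iff _).2 (Subgroup.subset_normalClosure ht)
    obtain ⟨φ, hφ⟩ := exists_hom (π.comp Monoid.Coprod.inl) (π.comp Monoid.Coprod.inr)
      (fun i j => by
        have := hπ _ (Set.mem_insert_of_mem _ ⟨(i, j), rfl⟩)
        simp only [groupComm, map_mul, map_inv] at this
        exact commute_of_groupComm_eq_one this)
      (by
        have := hπ _ (Set.mem_insert _ _)
        rwa [map_mul, map_inv, mul_inv_eq_one] at this)
    have hφq : φ.comp q = π := by
      apply Monoid.Coprod.hom_ext
      · ext x
        change φ (QuotientGroup.mk (_, 1)) = _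
        rw [hφ, map_one, mul_one]
      · ext y
        change φ (QuotientGroup.mk (1, _)) = _
        rw [hφ, map_one, one_mul]
    intro t ht
    have : π t = 1 := by
      rw [← hφq, MonoidHom.comp_apply, MonoidHom.mem_ker.1 ht, map_one]
    exact (QuotientGroup.eq_one_iff _).1 this

end Gamma

end CentralProductDehn

theorem theorem5p6 :
    AdmitsFillingPair (Gamma 4 3) (fun t => t ^ 3) (fun t => t) ∧
    ∀ (k : ℕ) (s : Fin k → Gamma 4 3) (R : Set (FreeGroup (Fin k))),
      IsFinitePresentation s R → AsympEq (dehn R) (fun n => ((n ^ 3 : ℕ) : ℕ∞)) := by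
  obtain ⟨φ, hφ⟩ := Gamma.exists_modelHom
  obtain ⟨ρ, ha, hx⟩ := Gamma.exists_swapHom
  refine ⟨⟨Gamma.isFinitelyPresented, fun k s R hP => ?_⟩, fun k s R hP => ⟨?_, ?_⟩⟩
  · obtain ⟨C, hC⟩ := exists_fillable_cubic hP hφ
    refine ⟨C + 1, by positivity, fun w hw => ?_⟩
    obtain ⟨F, h1, h2, h3⟩ := hC w hw
    refine ⟨F, h1, ?_, fun c hc => ?_⟩
    · have : (F.length : ℝ) ≤ C * w.norm ^ 3 := by exact_mod_cast h2
      have h0 : (0 : ℝ) ≤ (w.norm : ℝ) ^ 3 := by positivity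
      linarith
    · have : (c.1.norm : ℝ) ≤ C * w.norm := by exact_mod_cast h3 c hc
      have h0 : (0 : ℝ) ≤ (w.norm : ℝ) := by positivity
      linarith
  · obtain ⟨C, hC⟩ := exists_fillable_cubic hP hφ
    refine ⟨C + 1, fun n => iSup₂_le fun w hw => ?_⟩
    obtain ⟨F, h1, h2, -⟩ := hC w (by rw [← MonoidHom.mem_ker, hP.ker_eq]; exact hw.1)
    refine (iInf₂_le F h1).trans ?_
    have h3 : F.length ≤ (C + 1) * ((C + 1) * n + (C + 1)) ^ 3 + (C + 1) := by
      have h4 : w.norm ≤ (C + 1) * n + (C + 1) := by nlinarith [hw.2]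
      calc F.length ≤ C * w.norm ^ 3 := h2
        _ ≤ (C + 1) * ((C + 1) * n + (C + 1)) ^ 3 := by gcongr; omega
        _ ≤ _ := Nat.le_add_right _ _
    beta_reduce
    exact_mod_cast h3
  · exact cubic_asympLE_dehn hP Gamma.frame ρ ha hx
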